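/- Let $V=\bigoplus_{i\ge 1}V^i$ be a graded rational vector space, let $\Lambda V=\mathrm{Sym}(V^{even})\otimes \mathrm{Ext}(V^{odd})$ be the free graded commutative algebra on $V$, and let $\Lambda^kV$ be the span of the products of $k$ elements of $V$. Let $d$ be a differential on $\Lambda V$, that is, a graded derivation of degree $+1$ with $d^2=0$, such that $(\Lambda V,d)$ is a Sullivan algebra: $V$ is the union of graded subspaces $V(0)\subseteq V(1)\subseteq\cdots$ with $d(V(0))=0$ and $d(V(n+1))\subseteq\Lambda V(n)$ for all $n \ge 0$. Assume that $(\Lambda V,d)$ is coformal, in the sense that $d$ is purely quadratic, $d(V)\subseteq\Lambda^2V$ (so $(\Lambda V,d)$ is minimal), and elliptic, i.e. $\dim V<\infty$ and $\dim H^*(\Lambda V,d)<\infty$. For $k\ge 0$ let $H^*_k(\Lambda V,d)\subseteq H^*(\Lambda V,d)$ be the subspace of the classes that are represented by cocycles in $\Lambda^kV$. If $\ker(d\colon V\to\Lambda V)$ is concentrated in even degrees, then either $\dim H^*_k(\Lambda V,d)\ge 2$ for every $k=1,\dots,\dim V^{odd}-1$, or $H^*(\Lambda V,d)$ is a truncated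 polynomial algebra on a single generator, i.e. $H^*(\Lambda V,d)\cong\mathbb{Q}[x]/(x^m)$ as an algebra for some $m\ge 2$, where $x$ corresponds to a homogeneous class of positive degree. -/

import Mathlib

open scoped TensorProduct DirectSum

noncomputable section

namespace Sullivan

universe u

section FreeAlgebra

variable (V : ℕ → Type u) [∀ i, AddCommGroup (V i)] [∀ i, Module ℚ (V i)]

/-- The underlying vector space of the graded vector space `V = ⨁ Vⁱ`. -/
abbrev Total : Type u := ⨁ i : ℕ, V i

/-- The even part `V^even` of the graded vector space `V`. -/
abbrev EvenPart : Type u := ⨁ i : {i : ℕ // Even i}, V i.1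

/-- The odd part `V^odd` of the graded vector space `V`. -/
abbrev OddPart : Type u := ⨁ i : {i : ℕ // Odd i}, V i.1

/-- The free graded commutative algebra `ΛV = Sym(V^even) ⊗ Ext(V^odd)`. Elements of even degree
are central, so no sign enters the multiplication of the tensor product. -/
def Lam : Type u := SymmetricAlgebra ℚ (EvenPart V) ⊗[ℚ] ExteriorAlgebra ℚ (OddPart V)

instance : Ring (Lam V) :=
  inferInstanceAs (Ring (SymmetricAlgebra ℚ (EvenPart V) ⊗[ℚ] ExteriorAlgebra ℚ (OddPart V)))

instance : Algebra ℚ (Lam V) :=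
  inferInstanceAs (Algebra ℚ (SymmetricAlgebra ℚ (EvenPart V) ⊗[ℚ] ExteriorAlgebra ℚ (OddPart V)))

/-- `ΛV` unfolded to the tensor product of algebras that defines it. -/
def lamEquiv :
    Lam V ≃ₐ[ℚ] SymmetricAlgebra ℚ (EvenPart V) ⊗[ℚ] ExteriorAlgebra ℚ (OddPart V) :=
  AlgEquiv.refl

/-- The inclusion `Sym(V^even) → ΛV`. -/
def inl : SymmetricAlgebra ℚ (EvenPart V) →ₐ[ℚ] Lam V :=
  (lamEquiv V).symm.toAlgHom.comp Algebra.TensorProduct.includeLeft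

/-- The inclusion `Ext(V^odd) → ΛV`. -/
def inr : ExteriorAlgebra ℚ (OddPart V) →ₐ[ℚ] Lam V :=
  (lamEquiv V).symm.toAlgHom.comp Algebra.TensorProduct.includeRight

/-- The inclusion `Vⁱ → ΛV` of the generators of degree `i`. -/
def gen (i : ℕ) : V i →ₗ[ℚ] Lam V :=
  if h : Even i then
    (inl V).toLinearMap ∘ₗ SymmetricAlgebra.ι ℚ (EvenPart V) ∘ₗ
      DirectSum.lof ℚ {i : ℕ // Even i} (fun i => V i.1) ⟨i, h⟩
  else
    (inr V).toLinearMap ∘ₗ ExteriorAlgebra.ι ℚ ∘ₗ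
      DirectSum.lof ℚ {i : ℕ // Odd i} (fun i => V i.1) ⟨i, Nat.not_even_iff_odd.mp h⟩

/-- The product in `ΛV` of a word of homogeneous generators. -/
def word (l : List (Σ i, V i)) : Lam V := (l.map fun v => gen V v.1 v.2).prod

/-- `(ΛᵏV)ᵖ`: the span of the words of length `k` and total degree `p`. -/
def component (k p : ℕ) : Submodule ℚ (Lam V) :=
  Submodule.span ℚ {a | ∃ l : List (Σ i, V i),
    l.length = k ∧ (l.map Sigma.fst).sum = p ∧ word V l = a}

/-- `(ΛV)ᵖ`: the elements of degree `p`. -/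
def degreePart (p : ℕ) : Submodule ℚ (Lam V) := ⨆ k, component V k p

/-- `ΛᵏV`: the elements of word length `k`. -/
def lengthPart (k : ℕ) : Submodule ℚ (Lam V) := ⨆ p, component V k p

theorem gen_mem_adjoin (i : ℕ) (v : V i) :
    gen V i v ∈ Algebra.adjoin ℚ {a : Lam V | ∃ i, ∃ v : V i, gen V i v = a} :=
  Algebra.subset_adjoin ⟨i, v, rfl⟩

theorem adjoin_gen : Algebra.adjoin ℚ {a : Lam V | ∃ i, ∃ v : V i, gen V i v = a} = ⊤ := by
  set S := Algebra.adjoin ℚ {a : Lam V | ∃ i, ∃ v : V i, gen V i v = a} with hS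
  have hl : ∀ a : SymmetricAlgebra ℚ (EvenPart V),
      inl V a ∈ S := by
    intro a
    induction a using SymmetricAlgebra.induction with
    | algebraMap r => rw [AlgHom.commutes]; exact S.algebraMap_mem r
    | ι x =>
      induction x using DirectSum.induction_on with
      | zero => simp
      | of i x =>
        have h := gen_mem_adjoin V i.1 x
        rw [gen, dif_pos i.2] at h
        exact h
      | add x y hx hy => rw [map_add, map_add]; exact S.add_mem hx hy
    | mul a b ha hb => rw [map_mul]; exact S.mul_mem ha hb
    | add a b ha hb => rw [map_add]; exact S.add_mem ha hb
  have hr : ∀ a : ExteriorAlgebra ℚ (OddPart V),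
      inr V a ∈ S := by
    intro a
    induction a using ExteriorAlgebra.induction with
    | algebraMap r => rw [AlgHom.commutes]; exact S.algebraMap_mem r
    | ι x =>
      induction x using DirectSum.induction_on with
      | zero => simp
      | of i x =>
        have h := gen_mem_adjoin V i.1 x
        rw [gen, dif_neg (Nat.not_even_iff_odd.mpr i.2)] at h
        exact h
      | add x y hx hy => rw [map_add, map_add]; exact S.add_mem hx hy
    | mul a b ha hb => rw [map_mul]; exact S.mul_mem ha hb
    | add a b ha hb => rw [map_add]; exact S.add_mem ha hb
  refine eq_top_iff.mpr fun a _ => ?_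
  obtain ⟨a, rfl⟩ := (lamEquiv V).symm.surjective a
  induction a using TensorProduct.induction_on with
  | zero => rw [map_zero]; exact S.zero_mem
  | tmul x y =>
    have h : (lamEquiv V).symm (x ⊗ₜ[ℚ] y) = inl V x * inr V y := by
      have h' : x ⊗ₜ[ℚ] y = (x ⊗ₜ[ℚ] (1 : ExteriorAlgebra ℚ (OddPart V))) *
        ((1 : SymmetricAlgebra ℚ (EvenPart V)) ⊗ₜ[ℚ] y) := by simp
      rw [h', map_mul]
      rfl
    rw [h]; exact S.mul_mem (hl x) (hr y)
  | add a b ha hb => rw [map_add]; exact S.add_mem (ha trivial) (hb trivial)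

theorem iSup_degreePart : ⨆ p, degreePart V p = ⊤ := by
  refine eq_top_iff.mpr ?_
  have h : (⊤ : Submodule ℚ (Lam V)) = Subalgebra.toSubmodule ⊤ := rfl
  rw [h, ← adjoin_gen V, Algebra.adjoin_eq_span, Submodule.span_le]
  intro a ha
  have key : ∃ l : List (Σ i, V i), word V l = a := by
    induction ha using Submonoid.closure_induction with
    | mem a ha =>
      obtain ⟨i, v, rfl⟩ := ha
      exact ⟨[⟨i, v⟩], by simp [word]⟩
    | one => exact ⟨[], by simp [word]⟩
    | mul a b _ _ ha hb =>
      obtain ⟨l, rfl⟩ := ha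
      obtain ⟨l', rfl⟩ := hb
      exact ⟨l ++ l', by simp [word]⟩
  obtain ⟨l, rfl⟩ := key
  exact Submodule.mem_iSup_of_mem _ (Submodule.mem_iSup_of_mem _
    (Submodule.subset_span ⟨l, rfl, rfl, rfl⟩))

/-- The automorphism of `ΛV` that multiplies the elements of degree `p` by `(-1)ᵖ`. -/
def sign : Lam V →ₐ[ℚ] Lam V :=
  (lamEquiv V).symm.toAlgHom.comp
    ((Algebra.TensorProduct.map (AlgHom.id ℚ _) (ExteriorAlgebra.map (-LinearMap.id))).comp
      (lamEquiv V).toAlgHom)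

theorem sign_inl (x : SymmetricAlgebra ℚ (EvenPart V)) : sign V (inl V x) = inl V x := by
  simp [sign, inl]

theorem sign_inr (x : ExteriorAlgebra ℚ (OddPart V)) :
    sign V (inr V x) = inr V (ExteriorAlgebra.map (-LinearMap.id) x) := by
  simp [sign, inr]

theorem sign_gen (i : ℕ) (v : V i) : sign V (gen V i v) = (-1 : ℚ) ^ i • gen V i v := by
  by_cases h : Even i
  · simp [gen, dif_pos h, sign_inl, h.neg_one_pow]
  · have h' := Nat.not_even_iff_odd.mp h
    simp [gen, dif_neg h, sign_inr, h'.neg_one_pow]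

theorem sign_word (l : List (Σ i, V i)) :
    sign V (word V l) = (-1 : ℚ) ^ (l.map Sigma.fst).sum • word V l := by
  induction l with
  | nil => simp [word]
  | cons v l ih =>
    have h : word V (v :: l) = gen V v.1 v.2 * word V l := by simp [word]
    rw [h, map_mul, ih, sign_gen, smul_mul_smul_comm, ← pow_add, List.map_cons, List.sum_cons]

theorem sign_of_mem {p : ℕ} {a : Lam V} (ha : a ∈ degreePart V p) :
    sign V a = (-1 : ℚ) ^ p • a := by
  induction ha using Submodule.iSup_induction' with
  | mem k a ha =>
    induction ha using Submodule.span_induction with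
    | mem a ha =>
      obtain ⟨l, -, rfl, rfl⟩ := ha
      exact sign_word V l
    | zero => simp
    | add a b _ _ ha hb => rw [map_add, ha, hb, smul_add]
    | smul r a _ ha => rw [map_smul, ha, smul_comm]
  | zero => simp
  | add a b _ _ ha hb => rw [map_add, ha, hb, smul_add]

/-- A differential on `ΛV`: a graded derivation of degree `+1` and of square zero. -/
structure Differential where
  /-- the underlying linear map -/
  d : Lam V →ₗ[ℚ] Lam V
  map_degree : ∀ p, ∀ a ∈ degreePart V p, d a ∈ degreePart V (p + 1)
  leibniz : ∀ p, ∀ a ∈ degreePart V p, ∀ b, d (a * b) = d a * b + (-1 : ℚ) ^ p • (a * d b)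
  d_d : ∀ a, d (d a) = 0

end FreeAlgebra

namespace Differential

variable {V : ℕ → Type u} [∀ i, AddCommGroup (V i)] [∀ i, Module ℚ (V i)] (D : Differential V)

theorem d_mul_cocycle {b : Lam V} (hb : D.d b = 0) (x : Lam V) : D.d (x * b) = D.d x * b := by
  have hx : x ∈ ⨆ p, degreePart V p := by rw [iSup_degreePart]; trivial
  induction hx using Submodule.iSup_induction' with
  | mem p x hx => rw [D.leibniz p x hx, hb]; simp
  | zero => simp
  | add x y _ _ hx hy => rw [add_mul, map_add, hx, hy, map_add, add_mul]

theorem d_mul_eq_zero {a b : Lam V} (ha : D.d a = 0) (hb : D.d b = 0) : D.d (a * b) = 0 := by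
  rw [D.d_mul_cocycle hb, ha, zero_mul]

theorem d_algebraMap (r : ℚ) : D.d (algebraMap ℚ (Lam V) r) = 0 := by
  have h1 : (1 : Lam V) ∈ degreePart V 0 :=
    Submodule.mem_iSup_of_mem 0 (Submodule.subset_span ⟨[], rfl, rfl, by simp [word]⟩)
  have h := D.leibniz 0 1 h1 1
  simp only [mul_one, one_mul, pow_zero, one_smul] at h
  rw [Algebra.algebraMap_eq_smul_one, map_smul, left_eq_add.mp h, smul_zero]

/-- The algebra `ker d` of cocycles. -/
def cocycles : Subalgebra ℚ (Lam V) where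
  carrier := {a | D.d a = 0}
  mul_mem' := fun ha hb => D.d_mul_eq_zero ha hb
  add_mem' := fun {a b} ha hb => by
    change D.d (a + b) = 0
    rw [map_add, show D.d a = 0 from ha, show D.d b = 0 from hb, add_zero]
  algebraMap_mem' := D.d_algebraMap

theorem d_sign (a : Lam V) : D.d (sign V a) = -sign V (D.d a) := by
  have ha : a ∈ ⨆ p, degreePart V p := by rw [iSup_degreePart]; trivial
  induction ha using Submodule.iSup_induction' with
  | mem p a ha =>
    rw [sign_of_mem V ha, sign_of_mem V (D.map_degree p a ha), map_smul, pow_succ,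
      mul_neg_one, neg_smul, neg_neg]
  | zero => simp
  | add a b _ _ ha hb => rw [map_add, map_add, map_add, map_add, ha, hb, neg_add]

theorem d_sign_mul (a c : Lam V) : D.d (sign V a * c) = D.d (sign V a) * c + a * D.d c := by
  have ha : a ∈ ⨆ p, degreePart V p := by rw [iSup_degreePart]; trivial
  induction ha using Submodule.iSup_induction' with
  | mem p a ha =>
    rw [sign_of_mem V ha, D.leibniz p _ (Submodule.smul_mem _ _ ha), smul_mul_assoc, smul_smul,
      ← mul_pow]
    simp
  | zero => simp
  | add a b _ _ ha hb =>
    rw [map_add, add_mul, map_add, ha, hb, map_add, add_mul, add_mul]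
    abel

/-- The ideal `im d` of coboundaries in the algebra of cocycles. -/
def coboundaries : Ideal D.cocycles where
  carrier := {a | ∃ c, D.d c = a.1}
  zero_mem' := ⟨0, map_zero _⟩
  add_mem' := by
    rintro a b ⟨c, hc⟩ ⟨e, he⟩
    exact ⟨c + e, by rw [map_add, hc, he]; rfl⟩
  smul_mem' := by
    rintro ⟨a, ha⟩ b ⟨c, hc⟩
    have ha' : D.d a = 0 := ha
    refine ⟨sign V a * c, ?_⟩
    rw [D.d_sign_mul, D.d_sign, ha', map_zero, neg_zero, zero_mul, zero_add, hc]
    rfl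

instance coboundaries_isTwoSided : D.coboundaries.IsTwoSided where
  mul_mem_of_left := by
    rintro a ⟨b, hb⟩ ⟨c, hc⟩
    have hb' : D.d b = 0 := hb
    refine ⟨c * b, ?_⟩
    rw [D.d_mul_cocycle hb', hc]
    rfl

/-- The cohomology algebra `H^*(ΛV, d) = ker d / im d`. -/
abbrev Cohomology : Type u := D.cocycles ⧸ D.coboundaries

/-- The cohomology classes that are represented by a cocycle in the subspace `U` of `ΛV`. -/
def classesOf (U : Submodule ℚ (Lam V)) : Submodule ℚ D.Cohomology :=
  (U.comap D.cocycles.val.toLinearMap).map (Ideal.Quotient.mkₐ ℚ D.coboundaries).toLinearMap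

/-- `Hᵖ(ΛV, d)`: the classes of the cocycles of degree `p`. -/
def cohomologyDegree (p : ℕ) : Submodule ℚ D.Cohomology := D.classesOf (degreePart V p)

/-- `H_k^*(ΛV, d)`: the classes of the cocycles of word length `k`. -/
def cohomologyLength (k : ℕ) : Submodule ℚ D.Cohomology := D.classesOf (lengthPart V k)

/-- `(ΛV, d)` is a Sullivan algebra: `V` is concentrated in positive degrees and is the union of
an increasing sequence of graded subspaces `F 0 ⊆ F 1 ⊆ ...` such that `d` vanishes on `F 0` and
sends `F (n + 1)` into the subalgebra `Λ(F n)`. -/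
def IsSullivan : Prop :=
  (∀ v : V 0, v = 0) ∧
  ∃ F : ℕ → ∀ i, Submodule ℚ (V i),
    (∀ n i, F n i ≤ F (n + 1) i) ∧
    (∀ i, ∀ v : V i, ∃ n, v ∈ F n i) ∧
    (∀ i, ∀ v ∈ F 0 i, D.d (gen V i v) = 0) ∧
    ∀ n i, ∀ v ∈ F (n + 1) i,
      D.d (gen V i v) ∈ Algebra.adjoin ℚ {a : Lam V | ∃ j, ∃ w ∈ F n j, gen V j w = a}

/-- The differential is decomposable: `d V ⊆ Λ^{≥ 2} V`. -/
def IsMinimal : Prop := ∀ i, ∀ v : V i, D.d (gen V i v) ∈ ⨆ k ≥ 2, lengthPart V k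

/-- The differential is purely quadratic: `d V ⊆ Λ² V`. -/
def IsCoformal : Prop := ∀ i, ∀ v : V i, D.d (gen V i v) ∈ lengthPart V 2

theorem IsCoformal.isMinimal {D : Differential V} (h : D.IsCoformal) : D.IsMinimal :=
  fun i v => Submodule.mem_iSup_of_mem 2 (Submodule.mem_iSup_of_mem le_rfl (h i v))

/-- `(ΛV, d)` is elliptic: `dim V` and `dim H^*(ΛV, d)` are finite. -/
def IsElliptic : Prop := Module.Finite ℚ (Total V) ∧ Module.Finite ℚ D.Cohomology

/-- The kernel of `d : V → ΛV` (a graded subspace of `V`) is concentrated in even degrees. -/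
def KerConcentratedInEvenDegrees : Prop :=
  ∀ i, Odd i → ∀ v : V i, D.d (gen V i v) = 0 → v = 0

/-- `H^*(ΛV, d)` is a truncated polynomial algebra `ℚ[x] / (x ^ m)`, `m ≥ 2`, on a single
generator `x`, homogeneous of positive degree. -/
def IsTruncatedPolynomialCohomology : Prop :=
  ∃ n > 0, ∃ x ∈ D.cohomologyDegree n, ∃ m ≥ 2,
    ∃ e : (Polynomial ℚ ⧸ Ideal.span {(Polynomial.X : Polynomial ℚ) ^ m}) ≃ₐ[ℚ] D.Cohomology,
      e (Ideal.Quotient.mk _ Polynomial.X) = x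

end Differential

end Sullivan

end

/-! The first alternative always holds. Filter `ΛV` by killing basis vectors of `V` one at a time,
lowest degree first. Because `d` is quadratic and all generators have degree at least 2
(`IsSullivan.eq_zero_of_lt_two`), a generator `x` of lowest degree `i` among the remaining ones is a
cocycle in the current quotient: `dx` has degree `i + 1 < 2 * i`, so every quadratic term has a
factor that has already been killed. Everything is graded by word length, which `d` raises by one.

Let `b` and `c` be the dimensions of the cohomology, by word length, before and after killing `x`.
If `x` is even, the long exact sequence of multiplication by `x` gives `2 b_k = c_k + r_k +
r_{k+1}`, with `r_k` the rank of multiplication by `x` into length `k` (`exists_betti_even`). If `x`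
is odd, the connecting map `θ` is an endomorphism of the cohomology of the quotient which preserves
length and lowers degree by `i - 1 > 0`. Hence `b_{k+1} = δ_k + δ_{k+1}` with `δ_k` the dimension of
the kernel, equally of the cokernel, of `θ` in length `k`, and `δ_k ≠ 0` whenever `c_k ≠ 0`
(`exists_betti_odd`).

From these recursions alone, once `b_k = 0` for large `k`, one obtains numbers `β_k` with `b_k = β_k
+ β_{k+1}` for `k ≥ 1` and `β_k ≥ 1` for `1 ≤ k ≤ dim V^odd` (`BettiTower.exists_syzygy_ranks`). So
`b_k ≥ 2` for `1 ≤ k < dim V^odd`. The vanishing for large `k` comes from `dim H < ∞`, as the `H_k`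
are independent subspaces of `H`. -/

noncomputable section

namespace Sullivan

/-! ### Cohomology of complexes of subspaces of a fixed vector space -/

section Cohomology

variable {M : Type*} [AddCommGroup M] [Module ℚ M]

/-- The cohomology at `Q` of `P → Q → d Q`, where `P` and `Q` are subspaces of `M` and `d` is an
endomorphism of `M`. -/
abbrev Coh (d : M →ₗ[ℚ] M) (P Q : Submodule ℚ M) : Type _ :=
  ↥(Q ⊓ LinearMap.ker d) ⧸ (P.map d).submoduleOf (Q ⊓ LinearMap.ker d)

theorem Coh.mem_cycles {d : M →ₗ[ℚ] M} {Q : Submodule ℚ M} {a : M} :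
    a ∈ Q ⊓ LinearMap.ker d ↔ a ∈ Q ∧ d a = 0 := by
  rw [Submodule.mem_inf, LinearMap.mem_ker]

/-- The map on cohomology that an endomorphism of the ambient space induces. -/
def Coh.map {d d' : M →ₗ[ℚ] M} {P Q P' Q' : Submodule ℚ M} (φ : M →ₗ[ℚ] M)
    (hZ : ∀ a ∈ Q, d a = 0 → φ a ∈ Q' ∧ d' (φ a) = 0)
    (hB : ∀ p ∈ P, ∃ p' ∈ P', d' p' = φ (d p)) : Coh d P Q →ₗ[ℚ] Coh d' P' Q' :=
  Submodule.mapQ _ _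
    ((φ.comp (Q ⊓ LinearMap.ker d).subtype).codRestrict (Q' ⊓ LinearMap.ker d')
      fun a => Coh.mem_cycles.mpr (hZ a.1 (Coh.mem_cycles.mp a.2).1 (Coh.mem_cycles.mp a.2).2))
    (by
      rintro ⟨a, ha⟩ ⟨p, hp, hpa⟩
      obtain ⟨p', hp', h⟩ := hB p hp
      exact ⟨p', hp', h.trans (congrArg φ hpa)⟩)

theorem Coh.map_mk {d d' : M →ₗ[ℚ] M} {P Q P' Q' : Submodule ℚ M} (φ : M →ₗ[ℚ] M)
    (hZ : ∀ a ∈ Q, d a = 0 → φ a ∈ Q' ∧ d' (φ a) = 0)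
    (hB : ∀ p ∈ P, ∃ p' ∈ P', d' p' = φ (d p)) (a : M) (ha : a ∈ Q ⊓ LinearMap.ker d) :
    Coh.map φ hZ hB (Submodule.Quotient.mk ⟨a, ha⟩) =
      Submodule.Quotient.mk ⟨φ a, Coh.mem_cycles.mpr
        (hZ a (Coh.mem_cycles.mp ha).1 (Coh.mem_cycles.mp ha).2)⟩ := rfl

theorem Coh.mk_eq_zero {d : M →ₗ[ℚ] M} {P Q : Submodule ℚ M} (a : M)
    (ha : a ∈ Q ⊓ LinearMap.ker d) :
    (Submodule.Quotient.mk ⟨a, ha⟩ : Coh d P Q) = 0 ↔ ∃ p ∈ P, d p = a := by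
  rw [Submodule.Quotient.mk_eq_zero]
  rfl

theorem Coh.mk_eq_mk {d : M →ₗ[ℚ] M} {P Q : Submodule ℚ M} (a b : M)
    (ha : a ∈ Q ⊓ LinearMap.ker d) (hb : b ∈ Q ⊓ LinearMap.ker d) :
    (Submodule.Quotient.mk ⟨a, ha⟩ : Coh d P Q) = Submodule.Quotient.mk ⟨b, hb⟩ ↔
      ∃ p ∈ P, d p = a - b := by
  rw [Submodule.Quotient.eq]
  rfl

theorem Coh.map_exact {d d' d'' : M →ₗ[ℚ] M} {P Q P' Q' P'' Q'' : Submodule ℚ M}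
    {φ ψ : M →ₗ[ℚ] M}
    (hZ : ∀ a ∈ Q, d a = 0 → φ a ∈ Q' ∧ d' (φ a) = 0)
    (hB : ∀ p ∈ P, ∃ p' ∈ P', d' p' = φ (d p))
    (hZ' : ∀ a ∈ Q', d' a = 0 → ψ a ∈ Q'' ∧ d'' (ψ a) = 0)
    (hB' : ∀ p ∈ P', ∃ p' ∈ P'', d'' p' = ψ (d' p))
    (h₁ : ∀ z ∈ Q', d' z = 0 → (∃ p ∈ P'', d'' p = ψ z) →
      ∃ w ∈ Q, d w = 0 ∧ ∃ p ∈ P', d' p = φ w - z)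
    (h₂ : ∀ w ∈ Q, d w = 0 → ∃ p ∈ P'', d'' p = ψ (φ w)) :
    Function.Exact (Coh.map (P := P) φ hZ hB) (Coh.map ψ hZ' hB') := by
  intro x
  obtain ⟨⟨z, hz⟩, rfl⟩ := Submodule.Quotient.mk_surjective _ x
  rw [Coh.map_mk, Coh.mk_eq_zero]
  constructor
  · intro h
    obtain ⟨w, hw, hdw, h⟩ := h₁ z (Coh.mem_cycles.mp hz).1 (Coh.mem_cycles.mp hz).2 h
    refine ⟨Submodule.Quotient.mk ⟨w, Coh.mem_cycles.mpr ⟨hw, hdw⟩⟩, ?_⟩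
    rw [Coh.map_mk, Coh.mk_eq_mk]
    exact h
  · rintro ⟨y, hy⟩
    obtain ⟨⟨w, hw⟩, rfl⟩ := Submodule.Quotient.mk_surjective _ y
    rw [Coh.map_mk, Coh.mk_eq_mk] at hy
    obtain ⟨p, hp, h⟩ := hy
    obtain ⟨p', hp', h'⟩ := h₂ w (Coh.mem_cycles.mp hw).1 (Coh.mem_cycles.mp hw).2
    obtain ⟨p'', hp'', h''⟩ := hB' p hp
    refine ⟨p' - p'', Submodule.sub_mem _ hp' hp'', ?_⟩
    rw [map_sub, h', h'', h, map_sub, sub_sub_cancel]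

/-- Rank-nullity for `g`, `h` and `l`, with each kernel replaced by the preceding image. The ranks
of the two outer maps remain as correction terms. -/
theorem finrank_add_of_exact {A B C D E : Type*} [AddCommGroup A] [Module ℚ A]
    [AddCommGroup B] [Module ℚ B] [AddCommGroup C] [Module ℚ C] [AddCommGroup D] [Module ℚ D]
    [AddCommGroup E] [Module ℚ E] [Module.Finite ℚ B] [Module.Finite ℚ C] [Module.Finite ℚ D]
    {f : A →ₗ[ℚ] B} {g : B →ₗ[ℚ] C} {h : C →ₗ[ℚ] D} {l : D →ₗ[ℚ] E}
    (hfg : Function.Exact f g) (hgh : Function.Exact g h) (hhl : Function.Exact h l) :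
    Module.finrank ℚ C + Module.finrank ℚ (LinearMap.range f) +
      Module.finrank ℚ (LinearMap.range l) = Module.finrank ℚ B + Module.finrank ℚ D := by
  have h1 := LinearMap.finrank_range_add_finrank_ker g
  have h2 := LinearMap.finrank_range_add_finrank_ker h
  have h3 := LinearMap.finrank_range_add_finrank_ker l
  rw [hfg.linearMap_ker_eq] at h1
  rw [hgh.linearMap_ker_eq] at h2
  rw [hhl.linearMap_ker_eq] at h3
  omega

/-- The cohomology in degree `k` of a complex of subspaces of `M`. -/
abbrev CohAt (d : M →ₗ[ℚ] M) (P : ℤ → Submodule ℚ M) (k : ℤ) : Type _ := Coh d (P (k - 1)) (P k)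

/-- The index `k + 1 - 1` equals `k` only propositionally, so the two cohomology types are compared
by dimension. -/
theorem finrank_cohAt_shift (d : M →ₗ[ℚ] M) (P : ℤ → Submodule ℚ M) (k : ℤ) :
    Module.finrank ℚ (CohAt d (fun k => P (k - 1)) (k + 1)) = Module.finrank ℚ (CohAt d P k) := by
  have h : ∀ m, m = k → Module.finrank ℚ (CohAt d P m) = Module.finrank ℚ (CohAt d P k) := by
    rintro _ rfl
    rfl
  exact h _ (add_sub_cancel_right k 1)

/-! ### The long exact sequence of a short exact sequence of complexes -/

/-- A short exact sequence `0 → A → B → C → 0` of complexes of subspaces of `M`, where `C` is a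
graded subspace of `B` on which the projection `g` is the identity. -/
structure SplitSequence (dA dB dC f g r : M →ₗ[ℚ] M) (A B C : ℤ → Submodule ℚ M) : Prop where
  dB_mem : ∀ k, ∀ b ∈ B k, dB b ∈ B (k + 1)
  dB_dB : ∀ k, ∀ b ∈ B k, dB (dB b) = 0
  dA_mem : ∀ k, ∀ a ∈ A k, dA a ∈ A (k + 1)
  f_mem : ∀ k, ∀ a ∈ A k, f a ∈ B k
  f_d : ∀ k, ∀ a ∈ A k, f (dA a) = dB (f a)
  g_mem : ∀ k, ∀ b ∈ B k, g b ∈ C k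
  g_d : ∀ k, ∀ b ∈ B k, g (dB b) = dC (g b)
  le : ∀ k, C k ≤ B k
  g_eq : ∀ k, ∀ c ∈ C k, g c = c
  exists_f : ∀ k, ∀ b ∈ B k, g b = 0 → ∃ a ∈ A k, f a = b
  r_f : ∀ k, ∀ a ∈ A k, r (f a) = a
  g_f : ∀ k, ∀ a ∈ A k, g (f a) = 0

namespace SplitSequence

variable {dA dB dC f g r : M →ₗ[ℚ] M} {A B C : ℤ → Submodule ℚ M}
  (S : SplitSequence dA dB dC f g r A B C)

include S

theorem f_cycle (k : ℤ) : ∀ a ∈ A k, dA a = 0 → f a ∈ B k ∧ dB (f a) = 0 := fun a ha h =>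
  ⟨S.f_mem k a ha, by rw [← S.f_d k a ha, h, map_zero]⟩

theorem f_boundary (k : ℤ) : ∀ p ∈ A k, ∃ p' ∈ B k, dB p' = f (dA p) := fun p hp =>
  ⟨f p, S.f_mem k p hp, (S.f_d k p hp).symm⟩

theorem g_cycle (k : ℤ) : ∀ b ∈ B k, dB b = 0 → g b ∈ C k ∧ dC (g b) = 0 := fun b hb h =>
  ⟨S.g_mem k b hb, by rw [← S.g_d k b hb, h, map_zero]⟩

theorem g_boundary (k : ℤ) : ∀ p ∈ B k, ∃ p' ∈ C k, dC p' = g (dB p) := fun p hp =>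
  ⟨g p, S.g_mem k p hp, (S.g_d k p hp).symm⟩

/-- The snake construction: `c` is its own lift to `B`, and `dB c` dies in `C`, hence comes from
`A`. Since `dC` need not be the restriction of `dB`, `dB c` itself need not vanish. The retraction
`r` makes the choice of `a` linear in `c`. -/
theorem exists_f_eq_dB (k : ℤ) (c : M) (hc : c ∈ C k) (h : dC c = 0) :
    ∃ a ∈ A (k + 1), f a = dB c ∧ dA a = 0 ∧ r (dB c) = a := by
  have hcB := S.le k hc
  obtain ⟨a, ha, hfa⟩ := S.exists_f (k + 1) (dB c) (S.dB_mem k c hcB)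
    (by rw [S.g_d k c hcB, S.g_eq k c hc, h])
  refine ⟨a, ha, hfa, ?_, ?_⟩
  · rw [← S.r_f _ _ (S.dA_mem _ a ha), S.f_d _ a ha, hfa, S.dB_dB k c hcB, map_zero]
  · rw [← hfa, S.r_f _ a ha]

theorem exists_f_eq_sub (k : ℤ) (b : M) (hb : b ∈ B k) : ∃ a ∈ A k, f a = b - g b := by
  have hg := S.g_mem k b hb
  refine S.exists_f k _ (Submodule.sub_mem _ hb (S.le k hg)) ?_
  rw [map_sub, S.g_eq k _ hg, sub_self]

theorem connecting_cycle (k : ℤ) :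
    ∀ c ∈ C k, dC c = 0 → (r ∘ₗ dB) c ∈ A (k + 1) ∧ dA ((r ∘ₗ dB) c) = 0 := by
  intro c hc h
  obtain ⟨a, ha, -, hda, hra⟩ := S.exists_f_eq_dB k c hc h
  rw [LinearMap.comp_apply, hra]
  exact ⟨ha, hda⟩

theorem exists_dA_eq_r (k : ℤ) (b : M) (hb : b ∈ B k) (hb' : dB b = 0) :
    ∃ a ∈ A k, dA a = r (dB (g b)) := by
  obtain ⟨a, ha, hfa⟩ := S.exists_f_eq_sub k b hb
  refine ⟨-a, Submodule.neg_mem _ ha, ?_⟩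
  have : dB (g b) = f (-dA a) := by
    rw [map_neg, S.f_d k a ha, hfa, map_sub, hb', zero_sub, neg_neg]
  rw [this, S.r_f (k + 1) _ (Submodule.neg_mem _ (S.dA_mem k a ha)), map_neg]

theorem connecting_boundary (k : ℤ) :
    ∀ c ∈ C (k - 1), ∃ p' ∈ A k, dA p' = (r ∘ₗ dB) (dC c) := by
  intro c hc
  have hcB := S.le _ hc
  have h := S.dB_mem _ c hcB
  rw [sub_add_cancel] at h
  obtain ⟨a, ha, hfa⟩ := S.exists_dA_eq_r k (dB c) h (S.dB_dB _ c hcB)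
  refine ⟨a, ha, ?_⟩
  rw [hfa, S.g_d _ c hcB, S.g_eq _ c hc]
  rfl

/-- The connecting map `Hᵏ(C) → Hᵏ⁺¹(A)`. -/
def connecting (k : ℤ) : CohAt dC C k →ₗ[ℚ] CohAt dA A (k + 1) :=
  Coh.map (r ∘ₗ dB) (S.connecting_cycle k)
    (by rw [add_sub_cancel_right]; exact S.connecting_boundary k)

/-- The map `Hᵏ(A) → Hᵏ(B)`. -/
def mapF (k : ℤ) : CohAt dA A k →ₗ[ℚ] CohAt dB B k :=
  Coh.map f (S.f_cycle k) (S.f_boundary (k - 1))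

/-- The map `Hᵏ(B) → Hᵏ(C)`. -/
def mapG (k : ℤ) : CohAt dB B k →ₗ[ℚ] CohAt dC C k :=
  Coh.map g (S.g_cycle k) (S.g_boundary (k - 1))

theorem exact_mapF_mapG (k : ℤ) : Function.Exact (S.mapF k) (S.mapG k) := by
  refine Coh.map_exact _ _ _ _ ?_ ?_
  · rintro b hb hdb ⟨c, hc, hdc⟩
    have hcB := S.le _ hc
    have h := S.dB_mem _ c hcB
    rw [sub_add_cancel] at h
    obtain ⟨a, ha, hfa⟩ := S.exists_f k (b - dB c) (Submodule.sub_mem _ hb h)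
      (by rw [map_sub, S.g_d _ c hcB, S.g_eq _ c hc, hdc, sub_self])
    refine ⟨a, ha, ?_, -c, Submodule.neg_mem _ hcB, ?_⟩
    · rw [← S.r_f _ _ (S.dA_mem _ a ha), S.f_d _ a ha, hfa, map_sub, hdb, S.dB_dB _ c hcB, sub_zero,
        map_zero]
    · rw [hfa, map_neg, sub_sub_cancel_left]
  · intro a ha _
    exact ⟨0, Submodule.zero_mem _, by rw [S.g_f k a ha, map_zero]⟩

theorem exact_mapG_connecting (k : ℤ) : Function.Exact (S.mapG k) (S.connecting k) := by
  refine Coh.map_exact _ _ _ _ ?_ ?_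
  · rw [add_sub_cancel_right]
    rintro c hc hdc ⟨a, ha, hda⟩
    obtain ⟨a', -, hfa', -, hra'⟩ := S.exists_f_eq_dB k c hc hdc
    rw [LinearMap.comp_apply, hra'] at hda
    refine ⟨c - f a, Submodule.sub_mem _ (S.le k hc) (S.f_mem k a ha), ?_, 0,
      Submodule.zero_mem _, ?_⟩
    · rw [map_sub, ← S.f_d k a ha, hda, hfa', sub_self]
    · rw [map_sub, S.g_f k a ha, S.g_eq k c hc, sub_zero, sub_self, map_zero]
  · rw [add_sub_cancel_right]
    exact S.exists_dA_eq_r k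

theorem exact_connecting_mapF (k : ℤ) : Function.Exact (S.connecting k) (S.mapF (k + 1)) := by
  refine Coh.map_exact _ _ _ _ ?_ ?_
  · rw [add_sub_cancel_right]
    rintro a ha - ⟨b, hb, hdb⟩
    obtain ⟨a', ha', hfa'⟩ := S.exists_f_eq_sub k b hb
    refine ⟨g b, S.g_mem k b hb, ?_, -a', Submodule.neg_mem _ ha', ?_⟩
    · rw [← S.g_d k b hb, hdb, S.g_f _ a ha]
    · have : dB (g b) = f (a - dA a') := by
        rw [map_sub, S.f_d k a' ha', hfa', map_sub, hdb, sub_sub_cancel]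
      rw [LinearMap.comp_apply, this, S.r_f _ _ (Submodule.sub_mem _ ha (S.dA_mem k a' ha')),
        map_neg, sub_sub_cancel_left]
  · rw [add_sub_cancel_right]
    intro c hc hdc
    obtain ⟨a, -, hfa, -, hra⟩ := S.exists_f_eq_dB k c hc hdc
    exact ⟨c, S.le k hc, by rw [LinearMap.comp_apply, hra, hfa]⟩

theorem finrank_quotient [∀ k, Module.Finite ℚ (A k)] [∀ k, Module.Finite ℚ (B k)]
    [∀ k, Module.Finite ℚ (C k)] (k : ℤ) :
    Module.finrank ℚ (CohAt dC C k) + Module.finrank ℚ (LinearMap.range (S.mapF k)) +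
      Module.finrank ℚ (LinearMap.range (S.mapF (k + 1))) =
      Module.finrank ℚ (CohAt dB B k) + Module.finrank ℚ (CohAt dA A (k + 1)) :=
  finrank_add_of_exact (S.exact_mapF_mapG k) (S.exact_mapG_connecting k)
    (S.exact_connecting_mapF k)

theorem finrank_middle [∀ k, Module.Finite ℚ (A k)] [∀ k, Module.Finite ℚ (B k)]
    [∀ k, Module.Finite ℚ (C k)] (k : ℤ) :
    Module.finrank ℚ (CohAt dB B (k + 1)) + Module.finrank ℚ (LinearMap.range (S.connecting k)) +
      Module.finrank ℚ (LinearMap.range (S.connecting (k + 1))) =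
      Module.finrank ℚ (CohAt dA A (k + 1)) + Module.finrank ℚ (CohAt dC C (k + 1)) :=
  finrank_add_of_exact (S.exact_connecting_mapF k) (S.exact_mapF_mapG (k + 1))
    (S.exact_mapG_connecting (k + 1))

end SplitSequence

/-- An injective endomorphism that commutes with an automorphism up to a scalar that is not a root
of unity lives on the zero space. -/
theorem finrank_eq_zero_of_twisted {W : Type*} [AddCommGroup W] [Module ℚ W] [Module.Finite ℚ W]
    {θ T T' : W →ₗ[ℚ] W} {q : ℚ} (hq : 1 < q) (hT : T ∘ₗ T' = LinearMap.id)
    (hθ : Function.Injective θ) (h : T ∘ₗ θ = q • (θ ∘ₗ T)) : Module.finrank ℚ W = 0 := by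
  by_contra h0
  have h1 := congrArg LinearMap.det h
  -- Determinants turn `T θ = q θ T` into `det T * det θ = q ^ dim W * det θ * det T`, which forces
  -- `q ^ dim W = 1` when both determinants are nonzero.
  rw [LinearMap.det_smul, LinearMap.det_comp, LinearMap.det_comp] at h1
  have hT0 : LinearMap.det T ≠ 0 := by
    intro h
    have := congrArg LinearMap.det hT
    rw [LinearMap.det_comp, h, zero_mul, LinearMap.det_id] at this
    exact zero_ne_one this
  have hθ0 : LinearMap.det θ ≠ 0 := by
    have := (LinearEquiv.ofInjectiveEndo θ hθ).isUnit_det'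
    exact this.ne_zero
  have h2 : q ^ Module.finrank ℚ W = 1 := by
    have h3 : (q ^ Module.finrank ℚ W - 1) * (LinearMap.det T * LinearMap.det θ) = 0 := by
      linear_combination -h1
    rcases mul_eq_zero.mp h3 with h | h
    · exact sub_eq_zero.mp h
    · exact absurd h (mul_ne_zero hT0 hθ0)
  exact (one_lt_pow₀ hq h0).ne' h2

/-- The target `P'`, `Q'` is kept separate from `P`, `Q` because connecting maps land in a complex
whose indices agree with those of the source only after rewriting. -/
theorem Coh.finrank_eq_zero_of_twisted {d : M →ₗ[ℚ] M} {P Q P' Q' : Submodule ℚ M}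
    [Module.Finite ℚ Q] (hP : P' = P) (hQ : Q' = Q) {θ T T' : M →ₗ[ℚ] M} {q : ℚ} (hq : 1 < q)
    (hZ : ∀ a ∈ Q, d a = 0 → θ a ∈ Q' ∧ d (θ a) = 0)
    (hB : ∀ p ∈ P, ∃ p' ∈ P', d p' = θ (d p))
    (hTP : ∀ p ∈ P, T p ∈ P) (hTQ : ∀ p ∈ Q, T p ∈ Q)
    (hTP' : ∀ p ∈ P, T' p ∈ P) (hTQ' : ∀ p ∈ Q, T' p ∈ Q)
    (hTd : ∀ a, T (d a) = d (T a)) (hTd' : ∀ a, T' (d a) = d (T' a)) (hTT' : ∀ a, T (T' a) = a)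
    (hθT : ∀ a ∈ Q, d a = 0 → T (θ a) = q • θ (T a))
    (hinj : Function.Injective (Coh.map θ hZ hB)) : Module.finrank ℚ (Coh d P Q) = 0 := by
  subst hP hQ
  refine Sullivan.finrank_eq_zero_of_twisted (q := q)
    (T := Coh.map T (fun a ha h => ⟨hTQ a ha, by rw [← hTd, h, map_zero]⟩)
      fun p hp => ⟨T p, hTP p hp, (hTd p).symm⟩)
    (T' := Coh.map T' (fun a ha h => ⟨hTQ' a ha, by rw [← hTd', h, map_zero]⟩)
      fun p hp => ⟨T' p, hTP' p hp, (hTd' p).symm⟩) hq ?_ hinj ?_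
  · refine LinearMap.ext fun x => ?_
    obtain ⟨⟨a, ha⟩, rfl⟩ := Submodule.Quotient.mk_surjective _ x
    rw [LinearMap.comp_apply, Coh.map_mk, Coh.map_mk]
    simp only [hTT', LinearMap.id_apply]
  · refine LinearMap.ext fun x => ?_
    obtain ⟨⟨a, ha⟩, rfl⟩ := Submodule.Quotient.mk_surjective _ x
    rw [LinearMap.smul_apply, LinearMap.comp_apply, LinearMap.comp_apply, Coh.map_mk, Coh.map_mk,
      Coh.map_mk, Coh.map_mk, ← Submodule.Quotient.mk_smul]
    simp only [hθT a (Coh.mem_cycles.mp ha).1 (Coh.mem_cycles.mp ha).2]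
    rfl

end Cohomology

/-! ### Combinatorics of the recursion for the Betti numbers -/

/-- The recursion that the dimensions of the cohomology in the various word lengths satisfy when
the generators are adjoined in the order of decreasing degrees; the first argument counts the odd
generators. -/
inductive BettiTower : ℕ → (ℤ → ℕ) → Prop
  | base : BettiTower 0 fun k => if k = 0 then 1 else 0
  | even {N : ℕ} {b c : ℤ → ℕ} (r : ℤ → ℕ) (hc : BettiTower N c)
      (h : ∀ k, c k + r k + r (k + 1) = 2 * b k) (hr : ∀ k, r k ≤ b k) : BettiTower N b
  | odd {N : ℕ} {b c : ℤ → ℕ} (δ : ℤ → ℕ) (hc : BettiTower N c)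
      (h : ∀ k, b (k + 1) = δ k + δ (k + 1)) (hδ : ∀ k, c k ≠ 0 → δ k ≠ 0) : BettiTower (N + 1) b

namespace BettiTower

/-- Each odd step lengthens by one the range where `β` is positive, and each even step preserves it.
The vanishing of `b` in large lengths passes down the tower, which lets the induction run. -/
theorem exists_syzygy_ranks {N : ℕ} {b : ℤ → ℕ} (hb : BettiTower N b)
    (h0 : ∃ K : ℤ, ∀ k ≥ K, b k = 0) :
    b 0 ≠ 0 ∧ ∃ β : ℤ → ℕ, (∀ k ≥ 1, b k = β k + β (k + 1)) ∧
      (∀ k ≥ 1, k ≤ (N : ℤ) → β k ≠ 0) ∧ ∃ K : ℤ, ∀ k ≥ K, β k = 0 := by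
  induction hb with
  | base =>
    refine ⟨by simp, 0, fun k hk => ?_, fun k h1 h2 => ?_, 0, fun k _ => rfl⟩
    · simp only [Pi.zero_apply]
      rw [if_neg (by omega), add_zero]
    · push_cast at h2; omega
  | @even N b c r hc h hr ih =>
    obtain ⟨K, hK⟩ := h0
    have hcr : ∀ k ≥ K, c k = 0 ∧ r k = 0 := fun k hk => by
      have := hK k hk; have := h k; omega
    obtain ⟨hc0, γ, h1, h2, K', hK'⟩ := ih ⟨K, fun k hk => (hcr k hk).1⟩
    -- Consecutive terms `γ k + r k` have even sum `2 * b k` and the terms vanish for large `k`, so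
    -- descending induction makes all of them even.
    have heven : ∀ k ≥ (1 : ℤ), Even (γ k + r k) := by
      have key : ∀ n : ℕ, ∀ k ≥ (1 : ℤ), max K K' ≤ k + n → Even (γ k + r k) := by
        intro n
        induction n with
        | zero =>
          intro k _ hk
          rw [hK' k (by simp at hk; omega), (hcr k (by simp at hk; omega)).2]
          exact Even.zero
        | succ n ihn =>
          intro k hk1 hk
          have e := ihn (k + 1) (by omega) (by push_cast at hk; omega)
          have := h1 k hk1
          have := h k
          rw [Nat.even_iff] at e ⊢
          omega
      intro k hk
      exact key (max K K' - k).toNat k hk (by omega)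
    -- The halves are exact by `heven`; an even number that is at least `γ k ≥ 1` has nonzero half.
    refine ⟨by have := h 0; omega, fun k => (γ k + r k) / 2, fun k hk => ?_, fun k hk hN => ?_,
      max K K', fun k hk => ?_⟩
    · have e1 := heven k hk
      have e2 := heven (k + 1) (by omega)
      have := h1 k hk
      have := h k
      rw [Nat.even_iff] at e1 e2
      show b k = (γ k + r k) / 2 + (γ (k + 1) + r (k + 1)) / 2
      omega
    · have e1 := heven k hk
      have := h2 k hk hN
      rw [Nat.even_iff] at e1
      show (γ k + r k) / 2 ≠ 0
      omega
    · show (γ k + r k) / 2 = 0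
      rw [hK' k (by omega), (hcr k (by omega)).2]
  | @odd N b c δ hc h hδ ih =>
    obtain ⟨K, hK⟩ := h0
    have hδ0 : ∀ k ≥ K, δ k = 0 := fun k hk => by
      have := hK (k + 1) (by omega); have := h k; omega
    obtain ⟨hc0, γ, h1, h2, K', hK'⟩ := ih ⟨K, fun k hk => by
      by_contra hne; exact hδ k hne (hδ0 k hk)⟩
    have hδ' := hδ 0 hc0
    -- The shift by one is what extends positivity to `N + 1`: `β k` is positive as soon as `c (k -
    -- 1)` is, which for `k = 1` means `c 0 ≠ 0` and otherwise follows from `γ (k - 1) ≠ 0`.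
    refine ⟨by have := h (-1); simp at this; omega, fun k => δ (k - 1), fun k hk => ?_,
      fun k hk hN => ?_, K + 1, fun k hk => hδ0 _ (by omega)⟩
    · have := h (k - 1)
      rw [sub_add_cancel] at this
      simp only [add_sub_cancel_right]
      exact this
    · refine hδ _ ?_
      rcases eq_or_lt_of_le hk with rfl | hk
      · simpa using hc0
      · have := h1 (k - 1) (by omega)
        have := h2 (k - 1) (by omega) (by push_cast at hN; omega)
        omega

theorem two_le {N : ℕ} {b : ℤ → ℕ} (hb : BettiTower N b) (h0 : ∃ K : ℤ, ∀ k ≥ K, b k = 0) (k : ℤ)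
    (hk : 1 ≤ k) (hkN : k < N) : 2 ≤ b k := by
  obtain ⟨-, β, h1, h2, -⟩ := hb.exists_syzygy_ranks h0
  have := h1 k hk
  have := h2 k hk hkN.le
  have := h2 (k + 1) (by omega) (by omega)
  omega

end BettiTower

/-! ### Word length, functoriality, scalings and division by a generator in `ΛV` -/

section Structure

variable (V : ℕ → Type*) [∀ i, AddCommGroup (V i)] [∀ i, Module ℚ (V i)]

variable {V} in
theorem algHom_ext {B : Type*} [Semiring B] [Algebra ℚ B] {φ ψ : Lam V →ₐ[ℚ] B}
    (h : ∀ i (v : V i), φ (gen V i v) = ψ (gen V i v)) : φ = ψ := by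
  refine AlgHom.ext_of_adjoin_eq_top (adjoin_gen V) ?_
  rintro _ ⟨i, v, rfl⟩
  exact h i v

theorem word_nil : word V [] = 1 := rfl

theorem word_cons (v : Σ i, V i) (l : List (Σ i, V i)) :
    word V (v :: l) = gen V v.1 v.2 * word V l := by simp [word]

theorem word_append (l l' : List (Σ i, V i)) : word V (l ++ l') = word V l * word V l' := by
  simp [word]

/-- `ΛᵏV` for an integer `k`; it is zero for negative `k`. -/
def intLengthPart (k : ℤ) : Submodule ℚ (Lam V) :=
  Submodule.span ℚ {a | ∃ l : List (Σ i, V i), (l.length : ℤ) = k ∧ word V l = a}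

theorem word_mem_intLengthPart (l : List (Σ i, V i)) : word V l ∈ intLengthPart V l.length :=
  Submodule.subset_span ⟨l, rfl, rfl⟩

theorem word_mem_component (l : List (Σ i, V i)) :
    word V l ∈ component V l.length (l.map Sigma.fst).sum :=
  Submodule.subset_span ⟨l, rfl, rfl, rfl⟩

theorem component_le_lengthPart (k p : ℕ) : component V k p ≤ lengthPart V k :=
  le_iSup (component V k) p

theorem component_le_degreePart (k p : ℕ) : component V k p ≤ degreePart V p :=
  le_iSup (fun k => component V k p) k

theorem word_mem_degreePart (l : List (Σ i, V i)) :
    word V l ∈ degreePart V (l.map Sigma.fst).sum :=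
  component_le_degreePart V _ _ (word_mem_component V l)

theorem intLengthPart_natCast (k : ℕ) : intLengthPart V k = lengthPart V k := by
  apply le_antisymm
  · refine Submodule.span_le.mpr ?_
    rintro _ ⟨l, hl, rfl⟩
    obtain rfl : l.length = k := by exact_mod_cast hl
    exact component_le_lengthPart V _ _ (word_mem_component V l)
  · refine iSup_le fun p => Submodule.span_le.mpr ?_
    rintro _ ⟨l, rfl, -, rfl⟩
    exact word_mem_intLengthPart V l

theorem intLengthPart_of_neg {k : ℤ} (hk : k < 0) : intLengthPart V k = ⊥ := by
  rw [intLengthPart, Submodule.span_eq_bot]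
  rintro _ ⟨l, hl, rfl⟩
  omega

variable {V} in
theorem intLengthPart_induction {k : ℤ} {motive : ∀ a, a ∈ intLengthPart V k → Prop}
    (word : ∀ (l : List (Σ i, V i)) (hl : (l.length : ℤ) = k),
      motive (word V l) (Submodule.subset_span ⟨l, hl, rfl⟩))
    (zero : motive 0 (Submodule.zero_mem _))
    (add : ∀ a b ha hb, motive a ha → motive b hb → motive (a + b) (Submodule.add_mem _ ha hb))
    (smul : ∀ (r : ℚ) a ha, motive a ha → motive (r • a) (Submodule.smul_mem _ r ha)) {a : Lam V}
    (ha : a ∈ intLengthPart V k) : motive a ha := by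
  refine Submodule.span_induction ?_ zero add smul ha
  rintro _ ⟨l, hl, rfl⟩
  exact word l hl

theorem span_word : Submodule.span ℚ (Set.range (word V)) = ⊤ := by
  rw [eq_top_iff, ← iSup_degreePart V]
  refine iSup_le fun p => iSup_le fun k => Submodule.span_mono ?_
  rintro _ ⟨l, -, -, rfl⟩
  exact ⟨l, rfl⟩

variable {V} in
theorem linearMap_ext {B : Type*} [AddCommMonoid B] [Module ℚ B] {φ ψ : Lam V →ₗ[ℚ] B}
    (h : ∀ l, φ (word V l) = ψ (word V l)) : φ = ψ :=
  LinearMap.ext_on_range (span_word V) h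

variable {V} in
theorem mul_mem_intLengthPart {k m : ℤ} {a b : Lam V} (ha : a ∈ intLengthPart V k)
    (hb : b ∈ intLengthPart V m) : a * b ∈ intLengthPart V (k + m) := by
  induction ha using intLengthPart_induction with
  | word l hl =>
    induction hb using intLengthPart_induction with
    | word l' hl' =>
      rw [← word_append]
      exact Submodule.subset_span ⟨_, by simp [hl, hl'], rfl⟩
    | zero => rw [mul_zero]; exact Submodule.zero_mem _
    | add a b _ _ ha hb => rw [mul_add]; exact Submodule.add_mem _ ha hb
    | smul r a _ ha => rw [mul_smul_comm]; exact Submodule.smul_mem _ r ha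
  | zero => rw [zero_mul]; exact Submodule.zero_mem _
  | add a b _ _ ha hb => rw [add_mul]; exact Submodule.add_mem _ ha hb
  | smul r a _ ha => rw [smul_mul_assoc]; exact Submodule.smul_mem _ r ha

theorem gen_eq_word (i : ℕ) (v : V i) : gen V i v = word V [⟨i, v⟩] := by
  rw [word_cons, word_nil, mul_one]

theorem gen_mem_intLengthPart (i : ℕ) (v : V i) : gen V i v ∈ intLengthPart V 1 := by
  rw [gen_eq_word]
  exact word_mem_intLengthPart V [⟨i, v⟩]

theorem gen_mem_degreePart (i : ℕ) (v : V i) : gen V i v ∈ degreePart V i := by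
  rw [gen_eq_word]
  exact word_mem_degreePart V [⟨i, v⟩]

theorem fg_intLengthPart_one [Module.Finite ℚ (Total V)] : (intLengthPart V 1).FG := by
  have h : intLengthPart V 1 ≤ LinearMap.range (DirectSum.toModule ℚ ℕ (Lam V) (gen V)) := by
    refine Submodule.span_le.mpr ?_
    rintro _ ⟨l, hl, rfl⟩
    obtain ⟨v, rfl⟩ := List.length_eq_one_iff.mp (by exact_mod_cast hl : l.length = 1)
    refine ⟨DirectSum.lof ℚ ℕ V v.1 v.2, ?_⟩
    rw [DirectSum.toModule_lof, gen_eq_word]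
  exact Module.Finite.iff_fg.mp (Submodule.finiteDimensional_of_le h)

theorem finite_intLengthPart [Module.Finite ℚ (Total V)] (k : ℤ) :
    Module.Finite ℚ (intLengthPart V k) := by
  rcases lt_or_ge k 0 with hk | hk
  · rw [intLengthPart_of_neg V hk]
    infer_instance
  · lift k to ℕ using hk
    have h2 : intLengthPart V k ≤ intLengthPart V 1 ^ k := by
      refine Submodule.span_le.mpr ?_
      rintro _ ⟨l, hl, rfl⟩
      obtain rfl : l.length = k := by exact_mod_cast hl
      clear hl
      induction l with
      | nil =>
        rw [word_nil, List.length_nil, pow_zero]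
        exact Submodule.one_le.mp le_rfl
      | cons v l ih =>
        rw [word_cons, List.length_cons, pow_succ']
        exact Submodule.mul_mem_mul (gen_mem_intLengthPart V _ _) ih
    have : Module.Finite ℚ ↥(intLengthPart V 1 ^ k) :=
      Module.Finite.iff_fg.mpr ((fg_intLengthPart_one V).pow k)
    exact Submodule.finiteDimensional_of_le h2

/-! ### Functoriality -/

variable {V}

/-- The endomorphism of `ΛV` that a graded endomorphism of `V` induces. -/
def lamMap (f : ∀ i, V i →ₗ[ℚ] V i) : Lam V →ₐ[ℚ] Lam V :=
  (lamEquiv V).symm.toAlgHom.comp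
    ((Algebra.TensorProduct.map
      (SymmetricAlgebra.lift (SymmetricAlgebra.ι ℚ (EvenPart V) ∘ₗ DirectSum.lmap fun i => f i.1))
      (ExteriorAlgebra.map (DirectSum.lmap fun i => f i.1))).comp (lamEquiv V).toAlgHom)

theorem lamMap_gen (f : ∀ i, V i →ₗ[ℚ] V i) (i : ℕ) (v : V i) :
    lamMap f (gen V i v) = gen V i (f i v) := by
  by_cases h : Even i
  · simp only [gen, dif_pos h, lamMap, inl]
    simp [DirectSum.lmap_lof]
  · simp only [gen, dif_neg h, lamMap, inr]
    simp [DirectSum.lmap_lof]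

theorem lamMap_word (f : ∀ i, V i →ₗ[ℚ] V i) (l : List (Σ i, V i)) :
    lamMap f (word V l) = word V (l.map fun v => ⟨v.1, f v.1 v.2⟩) := by
  induction l with
  | nil => simp [word]
  | cons v l ih => rw [List.map_cons, word_cons, word_cons, map_mul, lamMap_gen, ih]

theorem lamMap_lamMap (f g : ∀ i, V i →ₗ[ℚ] V i) (a : Lam V) :
    lamMap f (lamMap g a) = lamMap (fun i => f i ∘ₗ g i) a := by
  rw [← AlgHom.comp_apply]
  congr 1
  exact algHom_ext fun i v => by
    rw [AlgHom.comp_apply, lamMap_gen, lamMap_gen, lamMap_gen, LinearMap.comp_apply]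

theorem lamMap_id (a : Lam V) : lamMap (fun i => (LinearMap.id : V i →ₗ[ℚ] V i)) a = a := by
  have : lamMap (fun i => (LinearMap.id : V i →ₗ[ℚ] V i)) = AlgHom.id ℚ (Lam V) :=
    algHom_ext fun i v => by rw [lamMap_gen]; rfl
  rw [this]; rfl

theorem lamMap_mem_intLengthPart (f : ∀ i, V i →ₗ[ℚ] V i) {k : ℤ} {a : Lam V}
    (ha : a ∈ intLengthPart V k) : lamMap f a ∈ intLengthPart V k := by
  induction ha using intLengthPart_induction with
  | word l hl =>
    rw [lamMap_word]
    exact Submodule.subset_span ⟨_, by simp [hl], rfl⟩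
  | zero => rw [map_zero]; exact Submodule.zero_mem _
  | add a b _ _ ha hb => rw [map_add]; exact Submodule.add_mem _ ha hb
  | smul r a _ ha => rw [map_smul]; exact Submodule.smul_mem _ r ha

theorem sign_sign (a : Lam V) : sign V (sign V a) = a := by
  have : (sign V).comp (sign V) = AlgHom.id ℚ (Lam V) := algHom_ext fun i v => by
    rw [AlgHom.comp_apply, sign_gen, map_smul, sign_gen, smul_smul, ← mul_pow]
    simp
  exact DFunLike.congr_fun this a

theorem sign_lamMap (f : ∀ i, V i →ₗ[ℚ] V i) (a : Lam V) :
    sign V (lamMap f a) = lamMap f (sign V a) := by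
  have : (sign V).comp (lamMap f) = (lamMap f).comp (sign V) := algHom_ext fun i v => by
    rw [AlgHom.comp_apply, AlgHom.comp_apply, sign_gen, lamMap_gen, map_smul, lamMap_gen, sign_gen]
  exact DFunLike.congr_fun this a

theorem sign_mem_intLengthPart {k : ℤ} {a : Lam V} (ha : a ∈ intLengthPart V k) :
    sign V a ∈ intLengthPart V k := by
  induction ha using intLengthPart_induction with
  | word l hl =>
    rw [sign_word]
    exact Submodule.smul_mem _ _ (Submodule.subset_span ⟨_, hl, rfl⟩)
  | zero => rw [map_zero]; exact Submodule.zero_mem _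
  | add a b _ _ ha hb => rw [map_add]; exact Submodule.add_mem _ ha hb
  | smul r a _ ha => rw [map_smul]; exact Submodule.smul_mem _ r ha

/-! ### Scalings and the independence of the gradings -/

variable (V) in
/-- The endomorphism of `ΛV` that multiplies the generators of degree `i` by `u * t ^ i`. -/
def scaling (u t : ℚ) : Lam V →ₐ[ℚ] Lam V := lamMap fun i => (u * t ^ i) • LinearMap.id

theorem scaling_gen (u t : ℚ) (i : ℕ) (v : V i) :
    scaling V u t (gen V i v) = (u * t ^ i) • gen V i v := by
  rw [scaling, lamMap_gen, LinearMap.smul_apply, LinearMap.id_apply, map_smul]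

theorem scaling_word (u t : ℚ) (l : List (Σ i, V i)) :
    scaling V u t (word V l) = (u ^ l.length * t ^ (l.map Sigma.fst).sum) • word V l := by
  induction l with
  | nil => simp [word]
  | cons v l ih =>
    rw [word_cons, map_mul, ih, scaling_gen, smul_mul_smul_comm]
    congr 1
    rw [List.length_cons, List.map_cons, List.sum_cons]
    ring

theorem scaling_of_mem_component (u t : ℚ) {k p : ℕ} {a : Lam V} (ha : a ∈ component V k p) :
    scaling V u t a = (u ^ k * t ^ p) • a := by
  induction ha using Submodule.span_induction with
  | mem a ha =>
    obtain ⟨l, rfl, rfl, rfl⟩ := ha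
    exact scaling_word u t l
  | zero => simp
  | add a b _ _ ha hb => rw [map_add, ha, hb, smul_add]
  | smul r a _ ha => rw [map_smul, ha, smul_comm]

/-- Scalings separate the gradings: distinct powers of 2 are distinct eigenvalues, so independence
of the graded pieces is independence of eigenspaces. -/
theorem lengthPart_le_eigenspace (k : ℕ) :
    lengthPart V k ≤ Module.End.eigenspace (scaling V 2 1).toLinearMap (2 ^ k) :=
  iSup_le fun p a ha => by
    rw [Module.End.mem_eigenspace_iff, AlgHom.toLinearMap_apply, scaling_of_mem_component 2 1 ha,
      one_pow, mul_one]

theorem degreePart_le_eigenspace (p : ℕ) :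
    degreePart V p ≤ Module.End.eigenspace (scaling V 1 2).toLinearMap (2 ^ p) :=
  iSup_le fun k a ha => by
    rw [Module.End.mem_eigenspace_iff, AlgHom.toLinearMap_apply, scaling_of_mem_component 1 2 ha,
      one_pow, one_mul]

theorem two_pow_injective : Function.Injective fun k : ℕ => (2 : ℚ) ^ k :=
  pow_right_injective₀ (by norm_num) (by norm_num)

theorem iSupIndep_eigenspace_two_pow {M : Type*} [AddCommGroup M] [Module ℚ M]
    (f : Module.End ℚ M) : iSupIndep fun k : ℕ => f.eigenspace (2 ^ k) :=
  f.eigenspaces_iSupIndep.comp two_pow_injective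

variable (V) in
theorem iSupIndep_degreePart : iSupIndep (degreePart V) :=
  (iSupIndep_eigenspace_two_pow _).mono degreePart_le_eigenspace

variable (V) in
theorem iSupIndep_lengthPart : iSupIndep (lengthPart V) :=
  (iSupIndep_eigenspace_two_pow _).mono lengthPart_le_eigenspace

/-- A subspace of a sum of independent subspaces `E i` that is itself the sum of subspaces of the
`E i` meets each `E i` in the corresponding summand. -/
theorem iSup_inf_le_of_iSupIndep {ι M : Type*} [AddCommGroup M] [Module ℚ M]
    {E F : ι → Submodule ℚ M} (hE : iSupIndep E) (hF : ∀ i, F i ≤ E i) (i : ι) :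
    (⨆ j, F j) ⊓ E i ≤ F i := by
  rintro a ⟨ha, hai⟩
  have hle : (⨆ j, F j) ≤ F i ⊔ ⨆ (j) (_ : j ≠ i), E j := iSup_le fun j => by
    by_cases h : j = i
    · subst h; exact le_sup_left
    · exact ((hF j).trans (le_iSup₂ (f := fun j (_ : j ≠ i) => E j) j h)).trans le_sup_right
  obtain ⟨u, hu, w, hw, rfl⟩ := Submodule.mem_sup.mp (hle ha)
  have hwi : w ∈ E i := by
    have := Submodule.sub_mem _ hai (hF i hu)
    rwa [add_sub_cancel_left] at this
  rw [Submodule.disjoint_def.mp (hE i) w hwi hw, add_zero]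
  exact hu

theorem lengthPart_inf_degreePart_le (k p : ℕ) :
    lengthPart V k ⊓ degreePart V p ≤ component V k p :=
  iSup_inf_le_of_iSupIndep (iSupIndep_degreePart V) (component_le_degreePart V k) p

/-! ### Commutation -/

theorem inl_commute (s : SymmetricAlgebra ℚ (EvenPart V)) (a : Lam V) :
    inl V s * a = a * inl V s := by
  obtain ⟨a, rfl⟩ := (lamEquiv V).symm.surjective a
  have : inl V s = (lamEquiv V).symm (s ⊗ₜ[ℚ] 1) := rfl
  rw [this, ← map_mul, ← map_mul]
  congr 1
  induction a using TensorProduct.induction_on with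
  | zero => simp
  | tmul x y => simp [mul_comm]
  | add a b ha hb => rw [mul_add, add_mul, ha, hb]

theorem gen_eq_inl {i : ℕ} (h : Even i) (v : V i) :
    gen V i v = inl V (SymmetricAlgebra.ι ℚ (EvenPart V)
      (DirectSum.lof ℚ {i : ℕ // Even i} (fun i => V i.1) ⟨i, h⟩ v)) := by
  rw [gen, dif_pos h]; rfl

theorem gen_eq_inr {i : ℕ} (h : Odd i) (v : V i) :
    gen V i v = inr V (ExteriorAlgebra.ι ℚ
      (DirectSum.lof ℚ {i : ℕ // Odd i} (fun i => V i.1) ⟨i, h⟩ v)) := by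
  rw [gen, dif_neg (Nat.not_even_iff_odd.mpr h)]; rfl

theorem gen_mul_gen {i j : ℕ} (v : V i) (w : V j) :
    gen V i v * gen V j w = (-1 : ℚ) ^ (i * j) • (gen V j w * gen V i v) := by
  rcases Nat.even_or_odd i with hi | hi
  · rw [(hi.mul_right j).neg_one_pow, one_smul, gen_eq_inl hi, inl_commute]
  rcases Nat.even_or_odd j with hj | hj
  · rw [(hj.mul_left i).neg_one_pow, one_smul, gen_eq_inl hj, inl_commute]
  · rw [(hi.mul hj).neg_one_pow, gen_eq_inr hi, gen_eq_inr hj, ← map_mul (inr V),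
      ← map_mul (inr V), neg_smul, one_smul, ← map_neg (inr V)]
    congr 1
    rw [eq_neg_iff_add_eq_zero]
    exact ExteriorAlgebra.ι_add_mul_swap _ _

theorem gen_mul_self {i : ℕ} (hi : Odd i) (v : V i) : gen V i v * gen V i v = 0 := by
  rw [gen_eq_inr hi, ← map_mul, ExteriorAlgebra.ι_sq_zero, map_zero]

/-! ### Division by a generator -/

/-- Multiplication by a nonzero element is injective on the domain `Sym(V^even)`, and tensoring with
the exterior algebra over a field preserves injectivity. -/
theorem gen_mul_injective {i : ℕ} (hi : Even i) {v : V i} (hv : v ≠ 0) :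
    Function.Injective fun a : Lam V => gen V i v * a := by
  set x := SymmetricAlgebra.ι ℚ (EvenPart V)
    (DirectSum.lof ℚ {i : ℕ // Even i} (fun i => V i.1) ⟨i, hi⟩ v) with hx
  have hx0 : x ≠ 0 := by
    have hw0 : DirectSum.lof ℚ {i : ℕ // Even i} (fun i => V i.1) ⟨i, hi⟩ v ≠ 0 := by
      intro h
      exact hv (DirectSum.of_injective (β := fun i : {i : ℕ // Even i} => V i.1) ⟨i, hi⟩
        (by rw [map_zero]; exact h))
    obtain ⟨f, hf⟩ := Module.Projective.exists_dual_ne_zero ℚ hw0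
    intro h
    have := congrArg (SymmetricAlgebra.lift f) h
    rw [hx, SymmetricAlgebra.lift_ι_apply, map_zero] at this
    exact hf this
  have h1 : Function.Injective (LinearMap.mulLeft ℚ x) := mul_right_injective₀ hx0
  have h2 := Module.Flat.rTensor_preserves_injective_linearMap
    (M := ExteriorAlgebra ℚ (OddPart V)) _ h1
  have h3 : ∀ a, LinearMap.rTensor (ExteriorAlgebra ℚ (OddPart V)) (LinearMap.mulLeft ℚ x) a =
      lamEquiv V (gen V i v * (lamEquiv V).symm a) := by
    intro a
    rw [map_mul, AlgEquiv.apply_symm_apply, gen_eq_inl hi]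
    change _ = (x ⊗ₜ[ℚ] 1) * a
    induction a using TensorProduct.induction_on with
    | zero => simp
    | tmul s e => simp
    | add a b ha hb => rw [map_add, mul_add, ha, hb]
  intro a b hab
  refine (lamEquiv V).injective (h2 ?_)
  rw [h3, h3, AlgEquiv.symm_apply_apply, AlgEquiv.symm_apply_apply]
  exact congrArg _ hab

/-- Contraction with a vector dual to the odd generator `v`. -/
theorem exists_contraction {i : ℕ} (hi : Odd i) {v : V i} (hv : v ≠ 0) :
    ∃ δ : Lam V →ₗ[ℚ] Lam V, ∀ a, δ (gen V i v * a) = a - gen V i v * δ a := by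
  set w := DirectSum.lof ℚ {i : ℕ // Odd i} (fun i => V i.1) ⟨i, hi⟩ v with hw
  have hw0 : w ≠ 0 := by
    intro h
    exact hv (DirectSum.of_injective (β := fun i : {i : ℕ // Odd i} => V i.1) ⟨i, hi⟩
      (by rw [map_zero]; exact h))
  obtain ⟨f, hf⟩ := Module.Projective.exists_dual_ne_zero ℚ hw0
  -- The functional is normalised to take the value 1 on `w`.
  set δ' : ExteriorAlgebra ℚ (OddPart V) →ₗ[ℚ] ExteriorAlgebra ℚ (OddPart V) :=
    CliffordAlgebra.contractLeft ((f w)⁻¹ • f) with hδ'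
  have hδ : ∀ e, δ' (ExteriorAlgebra.ι ℚ w * e) = e - ExteriorAlgebra.ι ℚ w * δ' e := by
    intro e
    have := CliffordAlgebra.contractLeft_ι_mul (Q := (0 : QuadraticForm ℚ (OddPart V)))
      (d := (f w)⁻¹ • f) w e
    rw [LinearMap.smul_apply, smul_eq_mul, inv_mul_cancel₀ hf, one_smul] at this
    exact this
  refine ⟨(lamEquiv V).symm.toLinearMap ∘ₗ δ'.lTensor (SymmetricAlgebra ℚ (EvenPart V)) ∘ₗ
    (lamEquiv V).toLinearMap, fun a => ?_⟩
  obtain ⟨a, rfl⟩ := (lamEquiv V).symm.surjective a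
  have hg : gen V i v = (lamEquiv V).symm (1 ⊗ₜ[ℚ] ExteriorAlgebra.ι ℚ w) := by
    rw [gen_eq_inr hi]; rfl
  simp only [LinearMap.comp_apply, AlgEquiv.toLinearMap_apply, hg, ← map_mul, ← map_sub,
    AlgEquiv.apply_symm_apply]
  congr 1
  induction a using TensorProduct.induction_on with
  | zero => simp
  | tmul s e => simp [hδ, TensorProduct.tmul_sub]
  | add a b ha hb => rw [mul_add, map_add, ha, hb, map_add, mul_add]; abel

/-- If `f` differs from the identity by multiples of `v`, then `a - Λf(a)` is a multiple of `v`. -/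
theorem exists_sub_lamMap_eq {i : ℕ} (v : V i) {f : ∀ j, V j →ₗ[ℚ] V j}
    (hf : ∀ j (w : V j), ∃ c : ℚ, gen V j w - gen V j (f j w) = c • gen V i v) {k : ℤ} {a : Lam V}
    (ha : a ∈ intLengthPart V (k + 1)) :
    ∃ b ∈ intLengthPart V k, gen V i v * b = a - lamMap f a := by
  induction ha using intLengthPart_induction with
  | word l hl =>
    induction l generalizing k with
    | nil => exact ⟨0, Submodule.zero_mem _, by simp [word_nil]⟩
    | cons u l ih =>
      have hl' : (l.length : ℤ) = k := by simpa using hl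
      obtain ⟨b, hb, hb'⟩ := ih (k := k - 1) (by omega)
      obtain ⟨c, hc⟩ := hf u.1 u.2
      -- Telescoping: `u l - f(u) f(l) = (u - f(u)) l + f(u) (l - f(l))`. The sign appears when `v`
      -- is moved to the left past `f(u)`.
      refine ⟨c • word V l + (-1 : ℚ) ^ (i * u.1) • (gen V u.1 (f u.1 u.2) * b), ?_, ?_⟩
      · refine Submodule.add_mem _ (Submodule.smul_mem _ _ (Submodule.subset_span ⟨l, hl', rfl⟩))
          (Submodule.smul_mem _ _ ?_)
        have := mul_mem_intLengthPart (gen_mem_intLengthPart V u.1 (f u.1 u.2)) hb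
        rwa [add_sub_cancel] at this
      · rw [word_cons, map_mul, lamMap_gen, mul_add, mul_smul_comm, mul_smul_comm, ← mul_assoc,
          gen_mul_gen, smul_mul_assoc, smul_smul, ← mul_pow, neg_one_mul, neg_neg, one_pow,
          one_smul, mul_assoc, hb', ← smul_mul_assoc, ← hc]
        noncomm_ring
  | zero => exact ⟨0, Submodule.zero_mem _, by simp⟩
  | add a b _ _ ha hb =>
    obtain ⟨x, hx, hx'⟩ := ha
    obtain ⟨y, hy, hy'⟩ := hb
    exact ⟨x + y, Submodule.add_mem _ hx hy, by rw [mul_add, hx', hy', map_add]; abel⟩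
  | smul r a _ ha =>
    obtain ⟨x, hx, hx'⟩ := ha
    exact ⟨r • x, Submodule.smul_mem _ r hx, by rw [mul_smul_comm, hx', map_smul, smul_sub]⟩

end Structure

/-! ### The quotients of `ΛV` by generators of low degree -/

section Stages

variable {V : ℕ → Type*} [∀ i, AddCommGroup (V i)] [∀ i, Module ℚ (V i)]

instance : Nontrivial (Lam V) := by
  let ε : SymmetricAlgebra ℚ (EvenPart V) ⊗[ℚ] ExteriorAlgebra ℚ (OddPart V) →ₐ[ℚ] ℚ :=
    Algebra.TensorProduct.productMap SymmetricAlgebra.algebraMapInv ExteriorAlgebra.algebraMapInv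
  exact (ε.comp (lamEquiv V).toAlgHom).toRingHom.domain_nontrivial

namespace Differential

variable (D : Differential V)

theorem d_one : D.d 1 = 0 := by
  have := D.d_algebraMap 1
  rwa [map_one] at this

theorem d_gen_mul (i : ℕ) (v : V i) (b : Lam V) :
    D.d (gen V i v * b) = D.d (gen V i v) * b + (-1 : ℚ) ^ i • (gen V i v * D.d b) :=
  D.leibniz i _ (gen_mem_degreePart V i v) b

variable {D}

theorem IsCoformal.d_mem (hC : D.IsCoformal) {k : ℤ} {a : Lam V} (ha : a ∈ intLengthPart V k) :
    D.d a ∈ intLengthPart V (k + 1) := by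
  induction ha using intLengthPart_induction with
  | word l hl =>
    induction l generalizing k with
    | nil => rw [word_nil, d_one]; exact Submodule.zero_mem _
    | cons v l ih =>
      have hl' : (l.length : ℤ) = k - 1 := by rw [← hl]; simp
      rw [word_cons, d_gen_mul]
      refine Submodule.add_mem _ ?_ (Submodule.smul_mem _ _ ?_)
      · have h1 := hC v.1 v.2
        rw [← intLengthPart_natCast] at h1
        have h2 := mul_mem_intLengthPart h1 (word_mem_intLengthPart V l)
        rw [hl'] at h2
        convert h2 using 2
        push_cast; ring
      · have h2 := mul_mem_intLengthPart (gen_mem_intLengthPart V v.1 v.2) (ih hl')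
        convert h2 using 2
        ring
  | zero => rw [map_zero]; exact Submodule.zero_mem _
  | add a b _ _ ha hb => rw [map_add]; exact Submodule.add_mem _ ha hb
  | smul r a _ ha => rw [map_smul]; exact Submodule.smul_mem _ r ha

theorem IsCoformal.d_mem_component (hC : D.IsCoformal) {k p : ℕ} {a : Lam V}
    (ha : a ∈ component V k p) : D.d a ∈ component V (k + 1) (p + 1) := by
  refine lengthPart_inf_degreePart_le _ _ ⟨?_, D.map_degree p a (component_le_degreePart V k p ha)⟩
  have h := component_le_lengthPart V k p ha
  rw [SetLike.mem_coe, ← intLengthPart_natCast]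
  rw [← intLengthPart_natCast] at h
  exact_mod_cast hC.d_mem h

/-- A quadratic `d` raises both length and degree by one, so it multiplies the scaling factor by `u
* t`. -/
theorem IsCoformal.scaling_d (hC : D.IsCoformal) {u t : ℚ} (hut : u * t = 1) (a : Lam V) :
    scaling V u t (D.d a) = D.d (scaling V u t a) := by
  have : (scaling V u t).toLinearMap ∘ₗ D.d = D.d ∘ₗ (scaling V u t).toLinearMap := by
    refine linearMap_ext fun l => ?_
    rw [LinearMap.comp_apply, LinearMap.comp_apply, AlgHom.toLinearMap_apply,
      AlgHom.toLinearMap_apply, scaling_of_mem_component u t (word_mem_component V l),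
      scaling_of_mem_component u t (hC.d_mem_component (word_mem_component V l)), map_smul]
    congr 1
    rw [pow_succ, pow_succ]
    linear_combination (u ^ l.length * t ^ (l.map Sigma.fst).sum) * hut
  exact LinearMap.congr_fun this a

theorem IsCoformal.d_gen_mem_component (hC : D.IsCoformal) (i : ℕ) (v : V i) :
    D.d (gen V i v) ∈ component V 2 (i + 1) := by
  have h := hC.d_mem_component (word_mem_component V [⟨i, v⟩])
  rw [← gen_eq_word] at h
  simpa using h

end Differential

open Classical in
/-- The graded endomorphism of `V` that sends the basis vectors in `s` to zero and fixes the others.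
-/
def kill {κ : ℕ → Type*} (b : ∀ i, Module.Basis (κ i) ℚ (V i)) (s : Set (Σ i, κ i)) (i : ℕ) :
    V i →ₗ[ℚ] V i :=
  (b i).constr ℚ fun j => if (⟨i, j⟩ : Σ i, κ i) ∈ s then 0 else b i j

section Kill

variable {κ : ℕ → Type*} (b : ∀ i, Module.Basis (κ i) ℚ (V i)) (s t : Set (Σ i, κ i))

open Classical in
theorem kill_basis (i : ℕ) (j : κ i) :
    kill b s i (b i j) = if (⟨i, j⟩ : Σ i, κ i) ∈ s then 0 else b i j :=
  (b i).constr_basis ℚ _ j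

theorem kill_comp (i : ℕ) : kill b s i ∘ₗ kill b t i = kill b (s ∪ t) i := by
  refine (b i).ext fun j => ?_
  rw [LinearMap.comp_apply, kill_basis, kill_basis]
  by_cases ht : (⟨i, j⟩ : Σ i, κ i) ∈ t
  · rw [if_pos ht, if_pos (Set.mem_union_right s ht), map_zero]
  · rw [if_neg ht, kill_basis]
    by_cases hs : (⟨i, j⟩ : Σ i, κ i) ∈ s
    · rw [if_pos hs, if_pos (Set.mem_union_left t hs)]
    · rw [if_neg hs, if_neg fun h => h.elim hs ht]

theorem kill_empty (i : ℕ) : kill b ∅ i = LinearMap.id :=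
  (b i).ext fun j => by simp [kill_basis]

theorem kill_eq_zero {i : ℕ} (h : ∀ j : κ i, (⟨i, j⟩ : Σ i, κ i) ∈ s) : kill b s i = 0 :=
  (b i).ext fun j => by simp [kill_basis, h j]

theorem lamMap_kill_kill (a : Lam V) :
    lamMap (kill b s) (lamMap (kill b t) a) = lamMap (kill b (s ∪ t)) a := by
  rw [lamMap_lamMap]
  congr 2
  exact funext (kill_comp b s t)

theorem scaling_lamMap (u t : ℚ) (f : ∀ i, V i →ₗ[ℚ] V i) (a : Lam V) :
    scaling V u t (lamMap f a) = lamMap f (scaling V u t a) := by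
  rw [scaling, lamMap_lamMap, lamMap_lamMap]
  congr 2
  funext i
  ext v
  simp

theorem gen_sub_gen_kill_singleton {i : ℕ} (j : κ i) (m : ℕ) (w : V m) :
    ∃ c : ℚ, gen V m w - gen V m (kill b {⟨i, j⟩} m w) = c • gen V i (b i j) := by
  suffices h : ∀ w, gen V m w - gen V m (kill b {⟨i, j⟩} m w) ∈
      Submodule.span ℚ {gen V i (b i j)} by
    obtain ⟨c, hc⟩ := Submodule.mem_span_singleton.mp (h w)
    exact ⟨c, hc.symm⟩
  intro w
  induction (b m).mem_span w using Submodule.span_induction with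
  | zero => simp
  | add x y _ _ hx hy =>
    rw [map_add, map_add, map_add, add_sub_add_comm]
    exact Submodule.add_mem _ hx hy
  | smul r x _ hx =>
    rw [map_smul, map_smul, map_smul, ← smul_sub]
    exact Submodule.smul_mem _ r hx
  | mem x hx =>
    obtain ⟨j', rfl⟩ := hx
    rw [kill_basis]
    split_ifs with h
    · rw [Set.mem_singleton_iff] at h
      obtain ⟨rfl, h⟩ := Sigma.mk.inj_iff.mp h
      obtain rfl := eq_of_heq h
      rw [map_zero, sub_zero]
      exact Submodule.mem_span_singleton_self _
    · rw [sub_self]; exact Submodule.zero_mem _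

end Kill

section Stage

variable {κ : ℕ → Type*} (b : ∀ i, Module.Basis (κ i) ℚ (V i)) (D : Differential V)

/-- A set of basis vectors that contains all basis vectors of lower degree than any of its
members. -/
def IsDegreeLower (s : Set (Σ i, κ i)) : Prop := ∀ x ∈ s, ∀ y : Σ i, κ i, y.1 < x.1 → y ∈ s

/-- The part of length `k` of the subalgebra of `ΛV` generated by the basis vectors not in `s`. -/
def stage (s : Set (Σ i, κ i)) (k : ℤ) : Submodule ℚ (Lam V) :=
  intLengthPart V k ⊓ LinearMap.eqLocus (lamMap (kill b s)).toLinearMap LinearMap.id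

variable {b} in
theorem mem_stage {s : Set (Σ i, κ i)} {k : ℤ} {a : Lam V} :
    a ∈ stage b s k ↔ a ∈ intLengthPart V k ∧ lamMap (kill b s) a = a := by
  rw [stage, Submodule.mem_inf, LinearMap.mem_eqLocus]
  rfl

/-- The differential that `d` induces on the quotient of `ΛV` by the ideal generated by the basis
vectors in `s`, identified with the subalgebra generated by the other basis vectors. -/
def stageD (s : Set (Σ i, κ i)) : Lam V →ₗ[ℚ] Lam V := (lamMap (kill b s)).toLinearMap ∘ₗ D.d

theorem stageD_apply (s : Set (Σ i, κ i)) (a : Lam V) :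
    stageD b D s a = lamMap (kill b s) (D.d a) := rfl

/-- The dimension of the cohomology in length `k` of the stage given by `s`. -/
def betti (s : Set (Σ i, κ i)) (k : ℤ) : ℕ :=
  Module.finrank ℚ (CohAt (stageD b D s) (stage b s) k)

theorem finite_stage [Module.Finite ℚ (Total V)] (s : Set (Σ i, κ i)) (k : ℤ) :
    Module.Finite ℚ (stage b s k) :=
  have := finite_intLengthPart V k
  Submodule.finiteDimensional_of_le (inf_le_left : stage b s k ≤ intLengthPart V k)

variable {b D}

theorem lamMap_mem_stage {f : ∀ i, V i →ₗ[ℚ] V i} {s : Set (Σ i, κ i)}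
    (hf : ∀ a, lamMap (kill b s) (lamMap f a) = lamMap f (lamMap (kill b s) a)) {k : ℤ} {a : Lam V}
    (ha : a ∈ stage b s k) : lamMap f a ∈ stage b s k := by
  rw [mem_stage] at ha ⊢
  exact ⟨lamMap_mem_intLengthPart f ha.1, by rw [hf, ha.2]⟩

theorem lamMap_kill_mem_stage {s : Set (Σ i, κ i)} {k : ℤ} {a : Lam V}
    (ha : a ∈ intLengthPart V k) : lamMap (kill b s) a ∈ stage b s k :=
  mem_stage.mpr ⟨lamMap_mem_intLengthPart _ ha, by rw [lamMap_kill_kill, Set.union_self]⟩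

/-- Two factors of degree at least `i` would have total degree at least `2 * i > i + 1`, so each
quadratic term of `d v` contains a generator of degree below `i`, which is killed. -/
theorem lamMap_kill_d_gen (hC : D.IsCoformal) {s : Set (Σ i, κ i)} {i : ℕ} (hi : 2 ≤ i)
    (hs : ∀ y : Σ i, κ i, y.1 < i → y ∈ s) (v : V i) :
    lamMap (kill b s) (D.d (gen V i v)) = 0 := by
  have h := hC.d_gen_mem_component i v
  generalize D.d (gen V i v) = a at h ⊢
  induction h using Submodule.span_induction with
  | mem a ha =>
    obtain ⟨l, hl, hsum, rfl⟩ := ha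
    obtain ⟨x, y, rfl⟩ := List.length_eq_two.mp hl
    simp only [List.map_cons, List.map_nil, List.sum_cons, List.sum_nil, add_zero] at hsum
    rw [lamMap_word, List.map_cons, List.map_cons, word_cons, word_cons]
    rcases lt_or_ge x.1 i with hx | hx
    · simp only [kill_eq_zero b s fun j => hs ⟨x.1, j⟩ hx, LinearMap.zero_apply, map_zero, zero_mul]
    · have hy : y.1 < i := by omega
      simp only [kill_eq_zero b s fun j => hs ⟨y.1, j⟩ hy, LinearMap.zero_apply, map_zero, zero_mul,
        mul_zero]
  | zero => rw [map_zero]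
  | add a b _ _ ha hb => rw [map_add, ha, hb, add_zero]
  | smul r a _ ha => rw [map_smul, ha, smul_zero]

/-- This expresses that the ideal generated by `s` is stable under `d`, so that `stageD` is the
differential of the quotient. By the Leibniz rule it suffices to check generators, and those in `s`
are handled by `lamMap_kill_d_gen`. -/
theorem lamMap_kill_d_lamMap_kill (hC : D.IsCoformal) (h2 : ∀ x : Σ i, κ i, 2 ≤ x.1)
    {s : Set (Σ i, κ i)} (hs : IsDegreeLower s) (a : Lam V) :
    lamMap (kill b s) (D.d (lamMap (kill b s) a)) = lamMap (kill b s) (D.d a) := by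
  have hgen : ∀ i (v : V i), lamMap (kill b s) (D.d (gen V i (kill b s i v))) =
      lamMap (kill b s) (D.d (gen V i v)) := by
    intro i v
    induction (b i).mem_span v using Submodule.span_induction with
    | zero => simp
    | add x y _ _ hx hy => simp only [map_add, hx, hy]
    | smul r x _ hx => simp only [map_smul, hx]
    | mem x hx =>
      obtain ⟨j, rfl⟩ := hx
      rw [kill_basis]
      split_ifs with h
      · rw [map_zero, map_zero, map_zero]
        exact (lamMap_kill_d_gen hC (h2 ⟨i, j⟩) (hs _ h) _).symm
      · rfl
  have : (lamMap (kill b s)).toLinearMap ∘ₗ D.d ∘ₗ (lamMap (kill b s)).toLinearMap =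
      (lamMap (kill b s)).toLinearMap ∘ₗ D.d := by
    refine linearMap_ext fun l => ?_
    simp only [LinearMap.comp_apply, AlgHom.toLinearMap_apply]
    induction l with
    | nil => rw [word_nil, map_one]
    | cons v l ih =>
      rw [word_cons, map_mul, lamMap_gen, D.d_gen_mul, D.d_gen_mul, map_add, map_add, map_mul,
        map_mul, map_smul, map_smul, map_mul, map_mul, ih, hgen, lamMap_kill_kill, Set.union_self,
        ← lamMap_gen, lamMap_kill_kill, Set.union_self]
  exact LinearMap.congr_fun this a

theorem stageD_mem (hC : D.IsCoformal) {s : Set (Σ i, κ i)} {k : ℤ} {a : Lam V}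
    (ha : a ∈ stage b s k) : stageD b D s a ∈ stage b s (k + 1) :=
  lamMap_kill_mem_stage (hC.d_mem (mem_stage.mp ha).1)

section Step

variable {s : Set (Σ i, κ i)} {i : ℕ} {j : κ i}

theorem lamMap_kill_insert (a : Lam V) : lamMap (kill b (insert ⟨i, j⟩ s)) a =
    lamMap (kill b {⟨i, j⟩}) (lamMap (kill b s) a) := by
  rw [lamMap_kill_kill, Set.singleton_union]

theorem lamMap_kill_gen_of_notMem (hj : (⟨i, j⟩ : Σ i, κ i) ∉ s) :
    lamMap (kill b s) (gen V i (b i j)) = gen V i (b i j) := by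
  rw [lamMap_gen, kill_basis, if_neg hj]

theorem lamMap_kill_gen_of_mem (hj : (⟨i, j⟩ : Σ i, κ i) ∈ s) :
    lamMap (kill b s) (gen V i (b i j)) = 0 := by
  rw [lamMap_gen, kill_basis, if_pos hj, map_zero]

theorem stage_insert_le (k : ℤ) : stage b (insert ⟨i, j⟩ s) k ≤ stage b s k := by
  intro a ha
  rw [mem_stage] at ha ⊢
  refine ⟨ha.1, ?_⟩
  rw [← ha.2, lamMap_kill_kill, Set.union_insert, Set.union_self]

theorem lamMap_kill_singleton_of_mem {k : ℤ} {a : Lam V}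
    (ha : a ∈ stage b (insert ⟨i, j⟩ s) k) : lamMap (kill b {⟨i, j⟩}) a = a := by
  rw [mem_stage] at ha
  rw [← ha.2, lamMap_kill_kill, Set.singleton_union, Set.insert_idem]

theorem lamMap_kill_singleton_mem {k : ℤ} {a : Lam V} (ha : a ∈ stage b s k) :
    lamMap (kill b {⟨i, j⟩}) a ∈ stage b (insert ⟨i, j⟩ s) k := by
  rw [mem_stage] at ha
  rw [← ha.2, ← lamMap_kill_insert]
  exact lamMap_kill_mem_stage ha.1

theorem lamMap_kill_singleton_stageD (hC : D.IsCoformal) (h2 : ∀ x : Σ i, κ i, 2 ≤ x.1)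
    (hs : IsDegreeLower (insert (⟨i, j⟩ : Σ i, κ i) s)) {k : ℤ} {a : Lam V}
    (ha : a ∈ stage b s k) : lamMap (kill b {⟨i, j⟩}) (stageD b D s a) =
      stageD b D (insert ⟨i, j⟩ s) (lamMap (kill b {⟨i, j⟩}) a) := by
  rw [mem_stage] at ha
  have h : lamMap (kill b {⟨i, j⟩}) a = lamMap (kill b (insert ⟨i, j⟩ s)) a := by
    rw [lamMap_kill_insert, ha.2]
  rw [stageD_apply, stageD_apply, ← lamMap_kill_insert, h, lamMap_kill_d_lamMap_kill hC h2 hs]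

theorem exists_gen_mul_eq (hj : (⟨i, j⟩ : Σ i, κ i) ∉ s) {k : ℤ} {a : Lam V}
    (ha : a ∈ stage b s k) (ha' : lamMap (kill b {⟨i, j⟩}) a = 0) :
    ∃ c ∈ stage b s (k - 1), gen V i (b i j) * c = a := by
  rw [mem_stage] at ha
  obtain ⟨c, hc, h⟩ := exists_sub_lamMap_eq (k := k - 1) (a := a) (b i j)
    (gen_sub_gen_kill_singleton b j) (by rw [sub_add_cancel]; exact ha.1)
  refine ⟨_, lamMap_kill_mem_stage hc, ?_⟩
  rw [← lamMap_kill_gen_of_notMem hj, ← map_mul, h, ha', sub_zero, ha.2]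

/-- The two arguments differ by a multiple of the odd generator, whose square is zero. -/
theorem gen_mul_lamMap_kill_singleton (hi : Odd i) {k : ℤ} {a : Lam V}
    (ha : a ∈ intLengthPart V k) :
    gen V i (b i j) * lamMap (kill b {⟨i, j⟩}) a = gen V i (b i j) * a := by
  obtain ⟨c, hc, h⟩ := exists_sub_lamMap_eq (k := k - 1) (a := a) (b i j)
    (gen_sub_gen_kill_singleton b j) (by rw [sub_add_cancel]; exact ha)
  rw [eq_sub_iff_add_eq'] at h
  nth_rewrite 2 [← h]
  rw [mul_add, ← mul_assoc, gen_mul_self hi, zero_mul, add_zero]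

theorem stageD_stageD (hC : D.IsCoformal) (h2 : ∀ x : Σ i, κ i, 2 ≤ x.1)
    (hs : IsDegreeLower s) (a : Lam V) : stageD b D s (stageD b D s a) = 0 := by
  rw [stageD_apply, stageD_apply, lamMap_kill_d_lamMap_kill hC h2 hs, D.d_d, map_zero]

theorem IsDegreeLower.mem_of_lt (hs : IsDegreeLower (insert (⟨i, j⟩ : Σ i, κ i) s))
    (y : Σ i, κ i) (hy : y.1 < i) : y ∈ s := by
  rcases hs _ (Set.mem_insert _ _) y hy with rfl | h
  · exact absurd hy (lt_irrefl _)
  · exact h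

theorem gen_mul_mem_stage (hj : (⟨i, j⟩ : Σ i, κ i) ∉ s) {k : ℤ} {a : Lam V}
    (ha : a ∈ stage b s (k - 1)) : gen V i (b i j) * a ∈ stage b s k := by
  rw [mem_stage] at ha ⊢
  refine ⟨?_, by rw [map_mul, lamMap_kill_gen_of_notMem hj, ha.2]⟩
  have := mul_mem_intLengthPart (gen_mem_intLengthPart V i (b i j)) ha.1
  rwa [add_sub_cancel] at this

/-- Multiplication by an even generator of lowest degree, and the quotient by that generator. -/
theorem exists_splitSequence_even (hC : D.IsCoformal) (h2 : ∀ x : Σ i, κ i, 2 ≤ x.1)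
    (hs : IsDegreeLower s) (hs' : IsDegreeLower (insert (⟨i, j⟩ : Σ i, κ i) s))
    (hj : (⟨i, j⟩ : Σ i, κ i) ∉ s) (hi : Even i) :
    ∃ f g r, SplitSequence (stageD b D s) (stageD b D s) (stageD b D (insert ⟨i, j⟩ s)) f g r
      (fun k => stage b s (k - 1)) (stage b s) (stage b (insert ⟨i, j⟩ s)) := by
  obtain ⟨r, hr⟩ := LinearMap.exists_leftInverse_of_injective
    (LinearMap.mulLeft ℚ (gen V i (b i j)))
    (LinearMap.ker_eq_bot.mpr (gen_mul_injective hi ((b i).ne_zero j)))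
  refine ⟨LinearMap.mulLeft ℚ (gen V i (b i j)), (lamMap (kill b {⟨i, j⟩})).toLinearMap, r,
    { dB_mem := fun k a ha => stageD_mem hC ha
      dB_dB := fun k a _ => stageD_stageD hC h2 hs a
      dA_mem := fun k a ha => ?_
      f_mem := fun k a ha => ?_
      f_d := fun k a ha => ?_
      g_mem := fun k a ha => by
        rw [AlgHom.toLinearMap_apply]
        exact lamMap_kill_singleton_mem ha
      g_d := fun k a ha => by
        rw [AlgHom.toLinearMap_apply, AlgHom.toLinearMap_apply]
        exact lamMap_kill_singleton_stageD hC h2 hs' ha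
      le := stage_insert_le
      g_eq := fun k a ha => by
        rw [AlgHom.toLinearMap_apply]
        exact lamMap_kill_singleton_of_mem ha
      exists_f := fun k a ha h => ?_
      r_f := fun k a _ => ?_
      g_f := fun k a _ => ?_ }⟩
  · have := stageD_mem hC ha
    rwa [show k - 1 + 1 = k + 1 - 1 by ring] at this
  · rw [LinearMap.mulLeft_apply]
    exact gen_mul_mem_stage hj ha
  · rw [LinearMap.mulLeft_apply, LinearMap.mulLeft_apply, stageD_apply, stageD_apply, D.d_gen_mul,
      map_add, map_mul, lamMap_kill_d_gen hC (h2 ⟨i, j⟩) hs'.mem_of_lt, zero_mul, zero_add,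
      hi.neg_one_pow, one_smul, map_mul, lamMap_kill_gen_of_notMem hj]
  · obtain ⟨c, hc, hc'⟩ := exists_gen_mul_eq hj ha h
    exact ⟨c, hc, hc'⟩
  · rw [← LinearMap.comp_apply, hr, LinearMap.id_apply]
  · rw [LinearMap.mulLeft_apply, AlgHom.toLinearMap_apply, map_mul,
      lamMap_kill_gen_of_mem (Set.mem_singleton _), zero_mul]

/-- Multiplication by an odd generator of lowest degree, and the quotient by that generator. -/
theorem exists_splitSequence_odd (hC : D.IsCoformal) (h2 : ∀ x : Σ i, κ i, 2 ≤ x.1)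
    (hs : IsDegreeLower s) (hs' : IsDegreeLower (insert (⟨i, j⟩ : Σ i, κ i) s))
    (hj : (⟨i, j⟩ : Σ i, κ i) ∉ s) (hi : Odd i) :
    ∃ g r, SplitSequence (stageD b D (insert ⟨i, j⟩ s)) (stageD b D s)
      (stageD b D (insert ⟨i, j⟩ s))
      (LinearMap.mulLeft ℚ (gen V i (b i j)) ∘ₗ (sign V).toLinearMap) g r
      (fun k => stage b (insert ⟨i, j⟩ s) (k - 1)) (stage b s) (stage b (insert ⟨i, j⟩ s)) := by
  obtain ⟨δ, hδ⟩ := exists_contraction hi ((b i).ne_zero j)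
  have hsign : ∀ {s : Set (Σ i, κ i)} {k : ℤ} {a : Lam V}, a ∈ stage b s k →
      sign V a ∈ stage b s k := fun {s k a} ha => by
    rw [mem_stage] at ha ⊢
    exact ⟨sign_mem_intLengthPart ha.1, by rw [← sign_lamMap, ha.2]⟩
  refine ⟨(lamMap (kill b {⟨i, j⟩})).toLinearMap,
    -- Contraction recovers the cofactor of the generator up to a multiple of the generator. Killing
    -- that generator removes the error, and `sign` undoes the twist in `f`.
    (sign V).toLinearMap ∘ₗ (lamMap (kill b {⟨i, j⟩})).toLinearMap ∘ₗ δ,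
    { dB_mem := fun k a ha => stageD_mem hC ha
      dB_dB := fun k a _ => stageD_stageD hC h2 hs a
      dA_mem := fun k a ha => ?_
      f_mem := fun k a ha => ?_
      f_d := fun k a ha => ?_
      g_mem := fun k a ha => by
        rw [AlgHom.toLinearMap_apply]
        exact lamMap_kill_singleton_mem ha
      g_d := fun k a ha => by
        rw [AlgHom.toLinearMap_apply, AlgHom.toLinearMap_apply]
        exact lamMap_kill_singleton_stageD hC h2 hs' ha
      le := stage_insert_le
      g_eq := fun k a ha => by
        rw [AlgHom.toLinearMap_apply]
        exact lamMap_kill_singleton_of_mem ha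
      exists_f := fun k a ha h => ?_
      r_f := fun k a ha => ?_
      g_f := fun k a _ => ?_ }⟩
  · have := stageD_mem hC ha
    rwa [show k - 1 + 1 = k + 1 - 1 by ring] at this
  · have ha' := hsign (stage_insert_le _ ha)
    rw [LinearMap.comp_apply, LinearMap.mulLeft_apply, AlgHom.toLinearMap_apply]
    exact gen_mul_mem_stage hj ha'
  -- Multiplication by an odd cocycle anticommutes with the differential, as does `sign`; their
  -- composite is a chain map.
  · have ha' := stage_insert_le _ ha
    rw [mem_stage] at ha'
    have hd := hC.d_mem ha'.1
    simp only [LinearMap.comp_apply, LinearMap.mulLeft_apply, AlgHom.toLinearMap_apply,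
      stageD_apply]
    rw [lamMap_kill_insert, sign_lamMap,
      gen_mul_lamMap_kill_singleton hi (sign_mem_intLengthPart (lamMap_mem_intLengthPart _ hd)),
      D.d_gen_mul, map_add, map_mul, lamMap_kill_d_gen hC (h2 ⟨i, j⟩) hs'.mem_of_lt, zero_mul,
      zero_add, hi.neg_one_pow, neg_smul, one_smul, map_neg, map_mul, lamMap_kill_gen_of_notMem hj,
      D.d_sign, map_neg, mul_neg, neg_neg, sign_lamMap]
  · obtain ⟨c, hc, rfl⟩ := exists_gen_mul_eq hj ha h
    refine ⟨sign V (lamMap (kill b {⟨i, j⟩}) c), hsign (lamMap_kill_singleton_mem hc), ?_⟩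
    rw [LinearMap.comp_apply, AlgHom.toLinearMap_apply, LinearMap.mulLeft_apply, sign_sign,
      gen_mul_lamMap_kill_singleton hi (mem_stage.mp hc).1]
  · simp only [LinearMap.comp_apply, LinearMap.mulLeft_apply, AlgHom.toLinearMap_apply]
    rw [hδ, map_sub, map_mul, lamMap_kill_gen_of_mem (Set.mem_singleton _), zero_mul, sub_zero,
      ← sign_lamMap, sign_sign, lamMap_kill_singleton_of_mem ha]
  · rw [LinearMap.comp_apply, LinearMap.mulLeft_apply, AlgHom.toLinearMap_apply, map_mul,
      lamMap_kill_gen_of_mem (Set.mem_singleton _), zero_mul]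

end Step

end Stage

end Stages

/-! ### The Betti numbers of the stages -/

section Betti

variable {V : ℕ → Type*} [∀ i, AddCommGroup (V i)] [∀ i, Module ℚ (V i)]
  {κ : ℕ → Type*} {b : ∀ i, Module.Basis (κ i) ℚ (V i)} {D : Differential V}

section Step

variable [Module.Finite ℚ (Total V)] {s : Set (Σ i, κ i)} {i : ℕ} {j : κ i}

/-- Here `r k` is the rank of multiplication by the generator, from cohomology in length `k - 1` to
length `k`. -/
theorem exists_betti_even (hC : D.IsCoformal) (h2 : ∀ x : Σ i, κ i, 2 ≤ x.1)
    (hs : IsDegreeLower s) (hs' : IsDegreeLower (insert (⟨i, j⟩ : Σ i, κ i) s))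
    (hj : (⟨i, j⟩ : Σ i, κ i) ∉ s) (hi : Even i) :
    ∃ r : ℤ → ℕ, (∀ k, betti b D (insert ⟨i, j⟩ s) k + r k + r (k + 1) = 2 * betti b D s k) ∧
      ∀ k, r k ≤ betti b D s k := by
  obtain ⟨f, g, r, S⟩ := exists_splitSequence_even (b := b) hC h2 hs hs' hj hi
  have h1 := finite_stage b s
  have h2 := finite_stage b (insert ⟨i, j⟩ s)
  have h3 : ∀ k : ℤ, Module.Finite ℚ ((fun k => stage b s (k - 1)) k) := fun k => h1 (k - 1)
  refine ⟨fun k => Module.finrank ℚ (LinearMap.range (S.mapF k)), fun k => ?_,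
    fun k => Submodule.finrank_le _⟩
  have h := S.finrank_quotient k
  rw [finrank_cohAt_shift] at h
  rw [two_mul]
  exact h

/-- Sub and quotient complex are both the next stage, so the connecting map is an endomorphism `θ`
of its cohomology in each length, and `δ k` is its nullity. An injective `θ` is impossible on a
nonzero finite-dimensional space because `θ` lowers degree by `i - 1 > 0`. -/
theorem exists_betti_odd (hC : D.IsCoformal) (h2 : ∀ x : Σ i, κ i, 2 ≤ x.1)
    (hs : IsDegreeLower s) (hs' : IsDegreeLower (insert (⟨i, j⟩ : Σ i, κ i) s))
    (hj : (⟨i, j⟩ : Σ i, κ i) ∉ s) (hi : Odd i) :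
    ∃ δ : ℤ → ℕ, (∀ k, betti b D s (k + 1) = δ k + δ (k + 1)) ∧
      ∀ k, betti b D (insert ⟨i, j⟩ s) k ≠ 0 → δ k ≠ 0 := by
  obtain ⟨g, r, S⟩ := exists_splitSequence_odd (b := b) hC h2 hs hs' hj hi
  have h1 := finite_stage b s
  have h1' := finite_stage b (insert ⟨i, j⟩ s)
  have h3 : ∀ k : ℤ, Module.Finite ℚ ((fun k => stage b (insert ⟨i, j⟩ s) (k - 1)) k) :=
    fun k => h1' (k - 1)
  have hle : ∀ k, Module.finrank ℚ (LinearMap.range (S.connecting k)) ≤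
      betti b D (insert ⟨i, j⟩ s) k := fun k => LinearMap.finrank_range_le _
  refine ⟨fun k => betti b D (insert ⟨i, j⟩ s) k -
    Module.finrank ℚ (LinearMap.range (S.connecting k)), fun k => ?_, fun k hk => ?_⟩
  · have h := S.finrank_middle k
    rw [finrank_cohAt_shift] at h
    change betti b D s (k + 1) + _ + _ =
      betti b D (insert ⟨i, j⟩ s) k + betti b D (insert ⟨i, j⟩ s) (k + 1) at h
    have := hle k
    have := hle (k + 1)
    simp only
    omega
  · intro h0
    refine hk ?_
    have hrank : LinearMap.ker (S.connecting k) = ⊥ := by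
      rw [← Submodule.finrank_eq_zero (R := ℚ)]
      have e1 := LinearMap.finrank_range_add_finrank_ker (S.connecting k)
      have e2 := hle k
      change _ = betti b D (insert ⟨i, j⟩ s) k at e1
      simp only at h0
      omega
    -- The scaling with `u = 2`, `t = 1 / 2` multiplies length `k`, degree `p` by `2 ^ (k - p)`. It
    -- commutes with the differential as `u * t = 1`, and with `θ` up to `2 ^ (i - 1)`, which
    -- exceeds 1 because `i ≥ 2`.
    have hq : (1 : ℚ) < 2 ^ i / 2 := by
      obtain ⟨m, rfl⟩ : ∃ m, i = m + 2 := ⟨i - 2, by have := h2 ⟨i, j⟩; simp only at this; omega⟩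
      rw [pow_add, lt_div_iff₀ (by norm_num)]
      have : (1 : ℚ) ≤ 2 ^ m := one_le_pow₀ (by norm_num)
      linarith
    have hmem : ∀ (u t : ℚ) (k : ℤ), ∀ a ∈ stage b (insert ⟨i, j⟩ s) k,
        (scaling V u t).toLinearMap a ∈ stage b (insert ⟨i, j⟩ s) k := fun u t k a ha =>
      lamMap_mem_stage (fun a => (scaling_lamMap u t _ a).symm) ha
    have hd : ∀ (s : Set (Σ i, κ i)) (u t : ℚ), u * t = 1 → ∀ a,
        (scaling V u t).toLinearMap (stageD b D s a) =
          stageD b D s ((scaling V u t).toLinearMap a) := fun s u t hut a => by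
      rw [AlgHom.toLinearMap_apply, AlgHom.toLinearMap_apply, stageD_apply, stageD_apply,
        scaling_lamMap, hC.scaling_d hut]
    have hinj : Function.Injective (S.connecting k) := LinearMap.ker_eq_bot.mp hrank
    have hTT' : ∀ a, (scaling V 2 (1 / 2)).toLinearMap ((scaling V (1 / 2) 2).toLinearMap a) = a := by
      intro a
      have : (scaling V 2 (1 / 2)).comp (scaling V (1 / 2) 2) = AlgHom.id ℚ (Lam V) :=
        algHom_ext fun m v => by
          rw [AlgHom.comp_apply, scaling_gen, map_smul, scaling_gen, smul_smul, AlgHom.id_apply]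
          have : (1 / 2 * 2 ^ m : ℚ) * (2 * (1 / 2) ^ m) = 1 := by
            rw [one_div, inv_pow]; field_simp
          rw [this, one_smul]
      exact DFunLike.congr_fun this a
    -- The differential of `c` is the generator times `θ c` up to sign, so the twist is the inverse
    -- of the factor `2 * (1 / 2) ^ i` by which the generator scales.
    have hθ : ∀ c ∈ stage b (insert ⟨i, j⟩ s) k, stageD b D (insert ⟨i, j⟩ s) c = 0 →
        (scaling V 2 (1 / 2)).toLinearMap ((r ∘ₗ stageD b D s) c) =
          (2 ^ i / 2 : ℚ) • (r ∘ₗ stageD b D s) ((scaling V 2 (1 / 2)).toLinearMap c) := by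
      intro c hc hdc
      obtain ⟨a, ha, hfa, -, hra⟩ := S.exists_f_eq_dB k c hc hdc
      have hT : stageD b D s ((scaling V 2 (1 / 2)).toLinearMap c) =
          (2 * (1 / 2) ^ i : ℚ) • (LinearMap.mulLeft ℚ (gen V i (b i j)) ∘ₗ (sign V).toLinearMap)
            ((scaling V 2 (1 / 2)).toLinearMap a) := by
        rw [← hd s _ _ (by norm_num), ← hfa]
        simp only [LinearMap.comp_apply, LinearMap.mulLeft_apply, AlgHom.toLinearMap_apply]
        rw [map_mul, scaling_gen, smul_mul_assoc, scaling, sign_lamMap]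
      rw [LinearMap.comp_apply, hra, LinearMap.comp_apply, hT, map_smul,
        S.r_f _ _ (hmem 2 (1 / 2) _ a ha), smul_smul]
      have : (2 ^ i / 2 : ℚ) * (2 * (1 / 2) ^ i) = 1 := by
        rw [one_div, inv_pow]; field_simp
      rw [this, one_smul]
    refine Coh.finrank_eq_zero_of_twisted ?_ ?_ hq _ _ (hmem 2 (1 / 2) _) (hmem 2 (1 / 2) _)
      (hmem (1 / 2) 2 _) (hmem (1 / 2) 2 _) (hd _ 2 (1 / 2) (by norm_num))
      (hd _ (1 / 2) 2 (by norm_num)) hTT' hθ hinj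
    · simp only [add_sub_cancel_right]
    · simp only [add_sub_cancel_right]

end Step

theorem stage_univ {k : ℤ} (hk : k ≠ 0) : stage b Set.univ k = ⊥ := by
  refine (Submodule.eq_bot_iff _).mpr fun a ha => ?_
  rw [mem_stage] at ha
  obtain ⟨ha, h⟩ := ha
  rw [← h]
  clear h
  induction ha using intLengthPart_induction with
  | word l hl =>
    rcases l with - | ⟨v, l⟩
    · exact absurd hl.symm hk
    · rw [lamMap_word, List.map_cons, word_cons]
      simp [kill_eq_zero b Set.univ fun j => Set.mem_univ (⟨v.1, j⟩ : Σ i, κ i)]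
  | zero => rw [map_zero]
  | add a b _ _ ha hb => rw [map_add, ha, hb, add_zero]
  | smul r a _ ha => rw [map_smul, ha, smul_zero]

theorem intLengthPart_zero : intLengthPart V 0 = Submodule.span ℚ {1} := by
  rw [intLengthPart]
  congr 1
  ext a
  constructor
  · rintro ⟨l, hl, rfl⟩
    obtain rfl : l = [] := List.length_eq_zero_iff.mp (by exact_mod_cast hl)
    rfl
  · rintro rfl
    exact ⟨[], rfl, rfl⟩

theorem betti_univ : betti b D Set.univ = fun k => if k = 0 then 1 else 0 := by
  funext k
  split_ifs with hk
  · subst hk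
    have h0 : stage b Set.univ 0 ⊓ LinearMap.ker (stageD b D Set.univ) = Submodule.span ℚ {1} := by
      apply le_antisymm
      · rw [← intLengthPart_zero]
        exact inf_le_left.trans inf_le_left
      · rw [Submodule.span_singleton_le_iff_mem, Coh.mem_cycles, mem_stage, intLengthPart_zero]
        exact ⟨⟨Submodule.mem_span_singleton_self _, map_one _⟩,
          by rw [stageD_apply, D.d_one, map_zero]⟩
    have h1 : ((stage b Set.univ (0 - 1)).map (stageD b D Set.univ)).submoduleOf
        (stage b Set.univ 0 ⊓ LinearMap.ker (stageD b D Set.univ)) = ⊥ := by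
      rw [stage_univ (k := 0 - 1) (by norm_num), Submodule.map_bot, Submodule.submoduleOf,
        Submodule.comap_bot, Submodule.ker_subtype]
    change Module.finrank ℚ (_ ⧸ _) = 1
    rw [(Submodule.quotEquivOfEqBot _ h1).finrank_eq, h0]
    exact finrank_span_singleton one_ne_zero
  · have h0 : stage b Set.univ k ⊓ LinearMap.ker (stageD b D Set.univ) = ⊥ := by
      rw [stage_univ hk, bot_inf_eq]
    have : Subsingleton ↥(stage b Set.univ k ⊓ LinearMap.ker (stageD b D Set.univ)) := by
      rw [h0]; infer_instance
    exact Module.finrank_zero_of_subsingleton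

open Classical in
theorem bettiTower_betti [Module.Finite ℚ (Total V)] [Fintype (Σ i, κ i)] (hC : D.IsCoformal)
    (h2 : ∀ x : Σ i, κ i, 2 ≤ x.1) (n : ℕ) (s : Finset (Σ i, κ i)) (hn : sᶜ.card = n)
    (hs : IsDegreeLower (s : Set (Σ i, κ i))) :
    BettiTower {x ∈ sᶜ | Odd x.1}.card (betti b D s) := by
  induction n generalizing s with
  | zero =>
    have h : s = Finset.univ := by
      rwa [Finset.card_eq_zero, Finset.compl_eq_empty_iff] at hn
    subst h
    rw [Finset.coe_univ, betti_univ, Finset.compl_univ, Finset.filter_empty, Finset.card_empty]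
    exact BettiTower.base
  | succ n ih =>
    -- Choosing a survivor of least degree keeps the enlarged set closed under passing to lower
    -- degrees.
    obtain ⟨⟨i, j⟩, hx, hmin⟩ := Finset.exists_min_image sᶜ Sigma.fst
      (Finset.card_pos.mp (by omega))
    have hj : (⟨i, j⟩ : Σ i, κ i) ∉ (s : Set (Σ i, κ i)) := by simpa using hx
    have hs' : IsDegreeLower (insert (⟨i, j⟩ : Σ i, κ i) (s : Set (Σ i, κ i))) := by
      intro x hx' y hy
      refine Set.mem_insert_of_mem _ ?_
      rcases hx' with rfl | hx'
      · by_contra hys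
        exact absurd (hmin y (by simpa using hys)) (not_le.mpr hy)
      · exact hs x hx' y hy
    have hcompl : sᶜ = insert (⟨i, j⟩ : Σ i, κ i) (insert (⟨i, j⟩ : Σ i, κ i) s)ᶜ := by
      rw [Finset.compl_insert, Finset.insert_erase hx]
    have hnot : (⟨i, j⟩ : Σ i, κ i) ∉ (insert (⟨i, j⟩ : Σ i, κ i) s)ᶜ := by simp
    have ih' := ih (insert ⟨i, j⟩ s)
      (by rw [hcompl, Finset.card_insert_of_notMem hnot] at hn; omega)
      (by rw [Finset.coe_insert]; exact hs')
    rw [Finset.coe_insert] at ih'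
    rw [hcompl, Finset.filter_insert]
    rcases Nat.even_or_odd i with hi | hi
    · rw [if_neg (by simpa using hi)]
      obtain ⟨r, h, hr⟩ := exists_betti_even (b := b) hC h2 hs hs' hj hi
      exact BettiTower.even r ih' h hr
    · rw [if_pos hi, Finset.card_insert_of_notMem fun h => hnot (Finset.mem_filter.mp h).1]
      obtain ⟨δ, h, hδ⟩ := exists_betti_odd (b := b) hC h2 hs hs' hj hi
      exact BettiTower.odd δ ih' h hδ

/-! ### The cohomology of `ΛV` -/

theorem iSup_lengthPart : ⨆ k, lengthPart V k = ⊤ := by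
  rw [eq_top_iff, ← span_word V, Submodule.span_le]
  rintro _ ⟨l, rfl⟩
  exact Submodule.mem_iSup_of_mem _ (component_le_lengthPart V _ _ (word_mem_component V l))

namespace Differential

/-- As `d` is homogeneous for word length, only the part of `c` of length `k - 1` contributes. Thus
being a coboundary in `ΛV` agrees with being one in the complex graded by length. -/
theorem IsCoformal.exists_d_eq (hC : D.IsCoformal) {k : ℕ} {c : Lam V}
    (h : D.d c ∈ lengthPart V k) : ∃ p ∈ intLengthPart V (k - 1), D.d p = D.d c := by
  have hF : ∀ m : ℕ, (intLengthPart V (m - 1)).map D.d ≤ lengthPart V m := fun m => by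
    rw [Submodule.map_le_iff_le_comap]
    intro a ha
    have := hC.d_mem ha
    rwa [sub_add_cancel, intLengthPart_natCast] at this
  refine iSup_inf_le_of_iSupIndep (iSupIndep_lengthPart V) hF k ⟨?_, h⟩
  have hc : c ∈ ⨆ k, lengthPart V k := by rw [iSup_lengthPart]; trivial
  have h1 := Submodule.mem_map_of_mem (f := D.d) hc
  rw [Submodule.map_iSup] at h1
  have hle : ⨆ m : ℕ, (lengthPart V m).map D.d ≤
      ⨆ m : ℕ, (intLengthPart V (m - 1)).map D.d := by
    refine iSup_le fun m => le_trans ?_ (le_iSup _ (m + 1))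
    rw [← intLengthPart_natCast]
    push_cast
    rw [add_sub_cancel_right]
  exact hle h1

variable (D) in
/-- The map that sends the cocycles of length `k` to their classes. -/
def classMap (k : ℕ) : ↥(lengthPart V k ⊓ LinearMap.ker D.d) →ₗ[ℚ] D.Cohomology :=
  (Ideal.Quotient.mkₐ ℚ D.coboundaries).toLinearMap ∘ₗ
    (lengthPart V k ⊓ LinearMap.ker D.d).subtype.codRestrict (Subalgebra.toSubmodule D.cocycles)
      fun a => (Coh.mem_cycles.mp a.2).2

theorem range_classMap (k : ℕ) : LinearMap.range (D.classMap k) = D.cohomologyLength k := by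
  apply le_antisymm
  · rintro _ ⟨⟨a, ha⟩, rfl⟩
    exact ⟨⟨a, (Coh.mem_cycles.mp ha).2⟩, (Coh.mem_cycles.mp ha).1, rfl⟩
  · rintro _ ⟨⟨a, ha'⟩, ha, rfl⟩
    exact ⟨⟨a, Coh.mem_cycles.mpr ⟨ha, ha'⟩⟩, rfl⟩

theorem IsCoformal.ker_classMap (hC : D.IsCoformal) (k : ℕ) : LinearMap.ker (D.classMap k) =
    ((intLengthPart V (k - 1)).map D.d).submoduleOf (lengthPart V k ⊓ LinearMap.ker D.d) := by
  ext ⟨a, ha⟩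
  rw [LinearMap.mem_ker]
  change Ideal.Quotient.mk D.coboundaries ⟨a, (Coh.mem_cycles.mp ha).2⟩ = 0 ↔ _
  rw [Ideal.Quotient.eq_zero_iff_mem]
  constructor
  · rintro ⟨c, hc⟩
    have hc' : D.d c = a := hc
    obtain ⟨p, hp, h⟩ := hC.exists_d_eq (k := k) (c := c) (by rw [hc']; exact ha.1)
    exact ⟨p, hp, h.trans hc'⟩
  · rintro ⟨p, -, h⟩
    exact ⟨p, h⟩

theorem IsCoformal.finrank_cohomologyLength (hC : D.IsCoformal) (k : ℕ) :
    Module.finrank ℚ (D.cohomologyLength k) = betti b D ∅ k := by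
  have hid : lamMap (kill b ∅) = AlgHom.id ℚ (Lam V) := by
    ext a
    rw [show kill b ∅ = fun i => LinearMap.id from funext (kill_empty b), lamMap_id]
    rfl
  have h1 : stageD b D ∅ = D.d := by rw [stageD, hid]; rfl
  have h2 : ∀ k, stage b ∅ k = intLengthPart V k := fun k => by
    rw [stage, hid]
    exact inf_eq_left.mpr fun a _ => rfl
  change _ = Module.finrank ℚ (Coh (stageD b D ∅) (stage b ∅ (k - 1)) (stage b ∅ k))
  rw [h1, h2, h2, intLengthPart_natCast]
  change _ = Module.finrank ℚ (_ ⧸ _)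
  rw [← hC.ker_classMap, (D.classMap k).quotKerEquivRange.finrank_eq, range_classMap]

theorem IsCoformal.scaling_length_d (hC : D.IsCoformal) (a : Lam V) :
    scaling V 2 1 (D.d a) = (2 : ℚ) • D.d (scaling V 2 1 a) := by
  have : (scaling V 2 1).toLinearMap ∘ₗ D.d = (2 : ℚ) • (D.d ∘ₗ (scaling V 2 1).toLinearMap) := by
    refine linearMap_ext fun l => ?_
    rw [LinearMap.smul_apply, LinearMap.comp_apply, LinearMap.comp_apply, AlgHom.toLinearMap_apply,
      AlgHom.toLinearMap_apply, scaling_of_mem_component 2 1 (word_mem_component V l),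
      scaling_of_mem_component 2 1 (hC.d_mem_component (word_mem_component V l)), map_smul,
      smul_smul]
    congr 1
    simp only [one_pow, mul_one]
    ring
  exact LinearMap.congr_fun this a

/-- The scaling by word length commutes with `d` up to a factor 2, so it preserves cocycles and
coboundaries and acts on cohomology, with classes of length `k` as eigenvectors for `2 ^ k`. -/
theorem IsCoformal.iSupIndep_cohomologyLength (hC : D.IsCoformal) :
    iSupIndep D.cohomologyLength := by
  let φ : D.cocycles →ₐ[ℚ] D.cocycles :=
    ((scaling V 2 1).comp D.cocycles.val).codRestrict D.cocycles fun a => by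
      have h := hC.scaling_length_d (a : Lam V)
      rw [show D.d (a : Lam V) = 0 from a.2, map_zero, eq_comm, smul_eq_zero] at h
      exact h.resolve_left (by norm_num)
  have hφ : D.coboundaries ≤ D.coboundaries.comap φ := by
    rintro a ⟨c, hc⟩
    refine ⟨(2 : ℚ) • scaling V 2 1 c, ?_⟩
    rw [map_smul, ← hC.scaling_length_d, hc]
    rfl
  let ψ : D.Cohomology →ₐ[ℚ] D.Cohomology := Ideal.quotientMapₐ D.coboundaries φ hφ
  have hle : ∀ k, D.cohomologyLength k ≤ Module.End.eigenspace ψ.toLinearMap (2 ^ k) := by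
    rintro k _ ⟨a, ha, rfl⟩
    rw [Module.End.mem_eigenspace_iff]
    have h : φ a = (2 : ℚ) ^ k • a := Subtype.ext
      (Module.End.mem_eigenspace_iff.mp (lengthPart_le_eigenspace k ha))
    change Ideal.Quotient.mkₐ ℚ D.coboundaries (φ a) = _
    rw [h, map_smul]
    rfl
  exact (iSupIndep_eigenspace_two_pow _).mono hle

/-- The generators of a coformal Sullivan algebra have degree at least two if no odd generator is a
cocycle. -/
theorem IsSullivan.eq_zero_of_lt_two (hS : D.IsSullivan) (hC : D.IsCoformal)
    (hker : D.KerConcentratedInEvenDegrees) (i : ℕ) (hi : i < 2) (v : V i) : v = 0 := by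
  obtain ⟨h0, F, -, hF, hF0, hFd⟩ := hS
  obtain rfl | rfl : i = 0 ∨ i = 1 := by omega
  · exact h0 v
  obtain ⟨n, hn⟩ := hF 1 v
  induction n generalizing v with
  | zero => exact hker 1 odd_one v (hF0 1 v hn)
  | succ n ih =>
    refine hker 1 odd_one v ?_
    classical
    -- By induction `F n` has nothing in degrees below 2, so killing those degrees fixes `d v`. On
    -- the other hand `d v` is quadratic of degree 2, so each of its terms has a factor of degree
    -- below 2 and is killed.
    set f : ∀ i, V i →ₗ[ℚ] V i := fun i => if i < 2 then 0 else LinearMap.id with hf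
    have h1 : lamMap f (D.d (gen V 1 v)) = D.d (gen V 1 v) := by
      have hle : Algebra.adjoin ℚ {a : Lam V | ∃ j, ∃ w ∈ F n j, gen V j w = a} ≤
          AlgHom.equalizer (lamMap f) (AlgHom.id ℚ (Lam V)) := by
        refine Algebra.adjoin_le ?_
        rintro _ ⟨j, w, hw, rfl⟩
        change lamMap f (gen V j w) = gen V j w
        rw [lamMap_gen]
        congr 1
        rcases lt_or_ge j 2 with hj | hj
        · have hw0 : w = 0 := by
            obtain rfl | rfl : j = 0 ∨ j = 1 := by omega
            · exact h0 w
            · exact ih w hw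
          rw [hw0, map_zero]
        · simp only [hf, if_neg (not_lt.mpr hj), LinearMap.id_apply]
      exact hle (hFd n 1 v hn)
    rw [← h1]
    have h := hC.d_gen_mem_component 1 v
    generalize D.d (gen V 1 v) = a at h ⊢
    induction h using Submodule.span_induction with
    | mem a ha =>
      obtain ⟨l, hl, hsum, rfl⟩ := ha
      obtain ⟨x, y, rfl⟩ := List.length_eq_two.mp hl
      simp only [List.map_cons, List.map_nil, List.sum_cons, List.sum_nil, add_zero] at hsum
      rw [lamMap_word, List.map_cons, List.map_cons, word_cons, word_cons]
      rcases lt_or_ge x.1 2 with hx | hx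
      · simp only [hf, if_pos hx, LinearMap.zero_apply, map_zero, zero_mul]
      · have hy : y.1 < 2 := by omega
        simp only [hf, if_pos hy, LinearMap.zero_apply, map_zero, zero_mul, mul_zero]
    | zero => rw [map_zero]
    | add a b _ _ ha hb => rw [map_add, ha, hb, add_zero]
    | smul r a _ ha => rw [map_smul, ha, smul_zero]

theorem IsCoformal.two_le_finrank_cohomologyLength (hC : D.IsCoformal) (hE : D.IsElliptic)
    (h2 : ∀ i < 2, ∀ v : V i, v = 0) (k : ℕ) (hk : 1 ≤ k)
    (hkN : k < Module.finrank ℚ (OddPart V)) : 2 ≤ Module.finrank ℚ (D.cohomologyLength k) := by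
  classical
  obtain ⟨hV, hH⟩ := hE
  let b : ∀ i, Module.Basis (Module.Free.ChooseBasisIndex ℚ (V i)) ℚ (V i) :=
    fun i => Module.Free.chooseBasis ℚ (V i)
  have : Finite (Σ i, Module.Free.ChooseBasisIndex ℚ (V i)) :=
    Module.Finite.finite_basis (M := Total V) (DFinsupp.basis b)
  have := Fintype.ofFinite (Σ i, Module.Free.ChooseBasisIndex ℚ (V i))
  have hdeg : ∀ x : Σ i, Module.Free.ChooseBasisIndex ℚ (V i), 2 ≤ x.1 := fun x => by
    by_contra h
    exact (b x.1).ne_zero x.2 (h2 x.1 (not_le.mp h) _)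
  have hT := bettiTower_betti (b := b) hC hdeg _ ∅ rfl (by simp [IsDegreeLower])
  have hN : Module.finrank ℚ (OddPart V) =
      {x ∈ (∅ : Finset (Σ i, Module.Free.ChooseBasisIndex ℚ (V i)))ᶜ | Odd x.1}.card := by
    rw [Module.finrank_eq_nat_card_basis (M := OddPart V)
      (DFinsupp.basis fun i : {i : ℕ // Odd i} => b i.1), Finset.compl_empty,
      ← Fintype.card_subtype, ← Nat.card_eq_fintype_card]
    exact Nat.card_congr
      { toFun := fun x => ⟨⟨x.1.1, x.2⟩, x.1.2⟩
        invFun := fun x => ⟨⟨x.1.1, x.2⟩, x.1.2⟩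
        left_inv := fun _ => rfl
        right_inv := fun _ => rfl }
  rw [← hN, Finset.coe_empty] at hT
  rw [hC.finrank_cohomologyLength (b := b)]
  refine hT.two_le ?_ k (by exact_mod_cast hk) (by exact_mod_cast hkN)
  -- A finite-dimensional space has only finitely many nonzero members in an independent family,
  -- whence the vanishing in large lengths.
  have hfin := WellFoundedGT.finite_ne_bot_of_iSupIndep hC.iSupIndep_cohomologyLength
  obtain ⟨K, hK⟩ := hfin.bddAbove
  refine ⟨K + 1, fun m hm => ?_⟩
  lift m to ℕ using by omega
  rw [← hC.finrank_cohomologyLength, Submodule.finrank_eq_zero]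
  by_contra h
  have : m ≤ K := hK h
  omega

end Differential

end Betti

end Sullivan

end

theorem theorem1p0p2 (V : ℕ → Type*) [∀ i, AddCommGroup (V i)] [∀ i, Module ℚ (V i)]
    (D : Sullivan.Differential V) (hS : D.IsSullivan) (hC : D.IsCoformal) (hE : D.IsElliptic)
    (hker : D.KerConcentratedInEvenDegrees) :
    (∀ k : ℕ, 1 ≤ k → k < Module.finrank ℚ (Sullivan.OddPart V) →
      2 ≤ Module.finrank ℚ (D.cohomologyLength k)) ∨
    D.IsTruncatedPolynomialCohomology :=
  Or.inl (hC.two_le_finrank_cohomologyLength hE (hS.eq_zero_of_lt_two hC hker))
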